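/- Let $N=\mathbb Z^n$ be the cocharacter lattice of a split real torus, $N_{\mathbb R}=\mathbb R^n$, and let $M=\mathbb Z^n$ be the character lattice, paired with $N_{\mathbb R}$ in the standard way. For a rational polyhedral cone $\sigma\subset N_{\mathbb R}$ put $H_\sigma=\{m\in M:\langle m,u\rangle\ge 0\text{ for all }u\in\sigma\}$ and $U_\sigma=\operatorname{Spec}\mathbb R[H_\sigma]$. For a fan $\Sigma$ in $N_{\mathbb R}$ (a finite non-empty set of pointed rational polyhedral cones, closed under taking faces, in which any two cones intersect in a common face) let $X_\Sigma$ be the toric variety glued from the $U_\rho$, $\rho\in\Sigma$, along the open subvarieties $U_{\rho\cap\rho'}$. It is complete if and only if $\bigcup_{\rho\in\Sigma}\rho=N_{\mathbb R}$. Let $V=U_\sigma$ be an affine toric variety, where $\sigma$ is a pointed rational polyhedral cone, and let $S\subset V(\mathbb R)$ be a closed semi-algebraic set that is the closure of its interior (in the Euclidean topology). Assume that (i) every regular function $f\in\mathbb R[V]=\mathbb R[H_\sigma]$ that is bounded on $S$ is constant, i.e. $B_V(S)=\mathbb R$; (ii) $V$ admits a toric $S$-compatible completion, i.e. there is a complete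 fan $\Sigma$ with $\sigma\in\Sigma$ such that, for $X=X_\Sigma\supset U_\sigma=V$ and for every irreducible component $Z$ of $X\setminus V$, the set $Z(\mathbb R)\cap\overline S$ is either empty or Zariski-dense in $Z$, where $\overline S$ is the closure of $S$ in $X(\mathbb R)$ in the Euclidean topology. Then the cone $\mathscr P_V(S)=\{f\in\mathbb R[V]: f\ge 0\text{ on }S\}$ is totally stable: for every finite-dimensional subspace $U$ of $\mathbb R[V]$ there is a finite-dimensional subspace $W$ of $\mathbb R[V]$ such that, for all $r\ge 2$ and all $f_1,\dots,f_r\in\mathscr P_V(S)$, if $f_1+\cdots+f_r\in U$ then $f_1,\dots,f_r\in W$. -/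

import Mathlib

open scoped BigOperators

namespace Toric

noncomputable section

/-! ### Rational cones and fans

The cocharacter lattice is `N = ℤⁿ`, with `N_ℝ = ℝⁿ`, and the character lattice is
`M = ℤⁿ`, paired with `N_ℝ` by the dot product. The split torus is `T(ℝ) = (ℝˣ)ⁿ`. -/

/-- The pairing `⟨m, u⟩` of a character `m ∈ M` with a vector `u ∈ N_ℝ`. -/
def pairing {n : ℕ} (m : Fin n → ℤ) (u : Fin n → ℝ) : ℝ := ∑ i, (m i : ℝ) * u i

/-- Convex cones in `N_ℝ` (containing `0`). -/
abbrev Cone (n : ℕ) := PointedCone ℝ (Fin n → ℝ)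

/-- `σ` is a rational polyhedral cone: it is generated by finitely many lattice vectors. -/
def IsRational {n : ℕ} (σ : Cone n) : Prop :=
  ∃ G : Finset (Fin n → ℤ),
    σ = PointedCone.hull ℝ ((fun (v : Fin n → ℤ) i => (v i : ℝ)) '' (G : Set (Fin n → ℤ)))

/-- `σ` is pointed (strongly convex): it contains no line. -/
def IsStronglyConvex {n : ℕ} (σ : Cone n) : Prop := ∀ u ∈ σ, -u ∈ σ → u = 0

/-- The semigroup `H_σ = M ∩ σ^*` of characters that are nonnegative on `σ`. -/
def dualMonoid {n : ℕ} (σ : Cone n) : AddSubmonoid (Fin n → ℤ) where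
  carrier := {m | ∀ u ∈ σ, 0 ≤ pairing m u}
  zero_mem' := by
    intro u _
    simp [pairing]
  add_mem' := by
    intro a b ha hb u hu
    have h : pairing (a + b) u = pairing a u + pairing b u := by
      simp [pairing, add_mul, Finset.sum_add_distrib]
    rw [h]
    exact add_nonneg (ha u hu) (hb u hu)

/-- `τ` is a face of `σ`: it is cut out of `σ` by a supporting hyperplane. The cones considered
are rational, so that every face is cut out by a lattice vector `m ∈ M ∩ σ^*`. -/
def IsFace {n : ℕ} (τ σ : Cone n) : Prop :=
  ∃ m ∈ dualMonoid σ, ∀ u, u ∈ τ ↔ u ∈ σ ∧ pairing m u = 0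

/-- A fan in `N_ℝ`: a finite non-empty set of pointed rational polyhedral cones, closed under
taking faces, in which any two cones intersect in a common face. -/
structure Fan (n : ℕ) where
  cones : Finset (Cone n)
  nonempty : cones.Nonempty
  rational : ∀ σ ∈ cones, IsRational σ
  stronglyConvex : ∀ σ ∈ cones, IsStronglyConvex σ
  face_mem : ∀ σ ∈ cones, ∀ τ : Cone n, IsFace τ σ → τ ∈ cones
  inter_face : ∀ σ ∈ cones, ∀ τ ∈ cones, IsFace (σ ⊓ τ) σ ∧ IsFace (σ ⊓ τ) τ

/-- A fan is complete if its cones cover `N_ℝ`; equivalently, its toric variety is complete. -/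
def Fan.IsComplete {n : ℕ} (F : Fan n) : Prop := ∀ u : Fin n → ℝ, ∃ σ ∈ F.cones, u ∈ σ

/-! ### Affine toric varieties -/

/-- The coordinate ring `ℝ[U_σ] = ℝ[H_σ]` of the affine toric variety `U_σ = Spec ℝ[H_σ]`. -/
abbrev CoordRing {n : ℕ} (σ : Cone n) : Type := AddMonoidAlgebra ℝ (dualMonoid σ)

lemma dualMonoid_anti {n : ℕ} {τ σ : Cone n} (h : τ ≤ σ) : dualMonoid σ ≤ dualMonoid τ :=
  fun _ hm u hu => hm u (h hu)

/-- For `τ ⊆ σ`, the inclusion `ℝ[H_σ] ⊆ ℝ[H_τ]`, i.e. the morphism `U_τ → U_σ`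
(an open immersion if `τ` is a face of `σ`). -/
def restrict {n : ℕ} {τ σ : Cone n} (h : τ ≤ σ) : CoordRing σ →ₐ[ℝ] CoordRing τ :=
  AddMonoidAlgebra.mapDomainAlgHom ℝ ℝ (AddSubmonoid.inclusion (dualMonoid_anti h))

/-- The set `U_σ(ℝ)` of real points of `U_σ`. -/
def RealPoints {n : ℕ} (σ : Cone n) : Type := CoordRing σ →ₐ[ℝ] ℝ

/-- The value `f(x)` of a regular function at a real point. -/
def eval {n : ℕ} {σ : Cone n} (f : CoordRing σ) (x : RealPoints σ) : ℝ :=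
  (show CoordRing σ →ₐ[ℝ] ℝ from x) f

/-- The Euclidean topology of `U_σ(ℝ)`: the coarsest one for which all regular functions are
continuous. -/
instance {n : ℕ} (σ : Cone n) : TopologicalSpace (RealPoints σ) :=
  TopologicalSpace.induced (fun x (f : CoordRing σ) => eval f x) Pi.topologicalSpace

/-- The map `U_τ(ℝ) → U_σ(ℝ)` on real points for `τ ⊆ σ`. -/
def RealPoints.map {n : ℕ} {τ σ : Cone n} (h : τ ≤ σ) (x : RealPoints τ) : RealPoints σ :=
  (show CoordRing τ →ₐ[ℝ] ℝ from x).comp (restrict h)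

/-- The point of the scheme `U_σ` underlying a real point. -/
def RealPoints.toSpec {n : ℕ} {σ : Cone n} (x : RealPoints σ) : PrimeSpectrum (CoordRing σ) :=
  ⟨RingHom.ker (show CoordRing σ →ₐ[ℝ] ℝ from x).toRingHom, RingHom.ker_isPrime _⟩

/-- A subset of `U_σ(ℝ)` is semi-algebraic if it is a Boolean combination of sets `{f > 0}` with
`f` a regular function on `U_σ`. -/
def IsSemialgebraic {n : ℕ} {σ : Cone n} (S : Set (RealPoints σ)) : Prop :=
  S ∈ BooleanSubalgebra.closure
    {A : Set (RealPoints σ) | ∃ f : CoordRing σ, A = {x | 0 < eval f x}}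

/-- The ring `B_V(S)` of regular functions on `V = U_σ` that are bounded on `S`. -/
def boundedFunctions {n : ℕ} {σ : Cone n} (S : Set (RealPoints σ)) :
    Subalgebra ℝ (CoordRing σ) where
  carrier := {f | ∃ c : ℝ, ∀ x ∈ S, |eval f x| ≤ c}
  mul_mem' := by
    rintro a b ⟨c, hc⟩ ⟨d, hd⟩
    refine ⟨c * d, fun x hx => ?_⟩
    have h : eval (a * b) x = eval a x * eval b x :=
      map_mul (show CoordRing σ →ₐ[ℝ] ℝ from x) a b
    rw [h, abs_mul]
    exact mul_le_mul (hc x hx) (hd x hx) (abs_nonneg _) ((abs_nonneg _).trans (hc x hx))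
  add_mem' := by
    rintro a b ⟨c, hc⟩ ⟨d, hd⟩
    refine ⟨c + d, fun x hx => ?_⟩
    have h : eval (a + b) x = eval a x + eval b x :=
      map_add (show CoordRing σ →ₐ[ℝ] ℝ from x) a b
    rw [h]
    exact (abs_add_le _ _).trans (add_le_add (hc x hx) (hd x hx))
  algebraMap_mem' := by
    intro r
    refine ⟨|r|, fun x _ => ?_⟩
    have h : eval (algebraMap ℝ (CoordRing σ) r) x = r :=
      (show CoordRing σ →ₐ[ℝ] ℝ from x).commutes r
    rw [h]

/-- The cone `P_V(S)` of regular functions on `V = U_σ` that are nonnegative on `S`. -/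
def nonnegFunctions {n : ℕ} {σ : Cone n} (S : Set (RealPoints σ)) : Set (CoordRing σ) :=
  {f | ∀ x ∈ S, 0 ≤ eval f x}

/-- Total stability of a set `P` of functions in a real vector space `A`: for every
finite-dimensional subspace `U` there is a finite-dimensional subspace `W` such that, whenever a
sum of `r ≥ 2` members of `P` lies in `U`, all the summands lie in `W`. -/
def IsTotallyStable {A : Type*} [AddCommGroup A] [Module ℝ A] (P : Set A) : Prop :=
  ∀ U : Submodule ℝ A, FiniteDimensional ℝ U →
    ∃ W : Submodule ℝ A, FiniteDimensional ℝ W ∧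
      ∀ r : ℕ, 2 ≤ r → ∀ f : Fin r → A, (∀ i, f i ∈ P) → ∑ i, f i ∈ U → ∀ i, f i ∈ W

/-! ### The toric variety of a fan

The toric variety `X_Σ` is glued from the affine varieties `U_ρ`, for `ρ ∈ Σ`, along the open
subvarieties `U_{ρ ∩ ρ'}`. Both its underlying Zariski topological space and its set of real points
with the Euclidean topology are obtained by this gluing, with the quotient topology. -/

/-- The gluing relation on the disjoint union of the spaces `Spec ℝ[H_ρ]`. -/
def Fan.SpaceRel {n : ℕ} (F : Fan n)
    (p q : Σ ρ : {ρ // ρ ∈ F.cones}, PrimeSpectrum (CoordRing ρ.1)) : Prop :=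
  ∃ z : PrimeSpectrum (CoordRing (p.1.1 ⊓ q.1.1)),
    PrimeSpectrum.comap (restrict (inf_le_left : p.1.1 ⊓ q.1.1 ≤ p.1.1)).toRingHom z = p.2 ∧
    PrimeSpectrum.comap (restrict (inf_le_right : p.1.1 ⊓ q.1.1 ≤ q.1.1)).toRingHom z = q.2

/-- The gluing relation on the disjoint union of the sets `U_ρ(ℝ)`. -/
def Fan.RealRel {n : ℕ} (F : Fan n) (p q : Σ ρ : {ρ // ρ ∈ F.cones}, RealPoints ρ.1) : Prop :=
  ∃ z : RealPoints (p.1.1 ⊓ q.1.1),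
    z.map (inf_le_left : p.1.1 ⊓ q.1.1 ≤ p.1.1) = p.2 ∧
    z.map (inf_le_right : p.1.1 ⊓ q.1.1 ≤ q.1.1) = q.2

/-- The underlying topological space of `X_Σ`, with the Zariski topology. -/
def Fan.Space {n : ℕ} (F : Fan n) : Type := Quot F.SpaceRel

instance {n : ℕ} (F : Fan n) : TopologicalSpace F.Space :=
  inferInstanceAs (TopologicalSpace (Quot F.SpaceRel))

/-- The set `X_Σ(ℝ)` of real points of `X_Σ`, with the Euclidean topology. -/
def Fan.Real {n : ℕ} (F : Fan n) : Type := Quot F.RealRel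

instance {n : ℕ} (F : Fan n) : TopologicalSpace F.Real :=
  inferInstanceAs (TopologicalSpace (Quot F.RealRel))

/-- The chart `U_σ → X_Σ` on underlying spaces. -/
def Fan.chart {n : ℕ} (F : Fan n) {σ : Cone n} (hσ : σ ∈ F.cones)
    (p : PrimeSpectrum (CoordRing σ)) : F.Space :=
  Quot.mk _ ⟨⟨σ, hσ⟩, p⟩

/-- The chart `U_σ(ℝ) → X_Σ(ℝ)` on real points. -/
def Fan.realChart {n : ℕ} (F : Fan n) {σ : Cone n} (hσ : σ ∈ F.cones) (x : RealPoints σ) :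
    F.Real :=
  Quot.mk _ ⟨⟨σ, hσ⟩, x⟩

lemma RealPoints.toSpec_map {n : ℕ} {τ σ : Cone n} (h : τ ≤ σ) (x : RealPoints τ) :
    PrimeSpectrum.comap (restrict h).toRingHom x.toSpec = (x.map h).toSpec := rfl

/-- The point of the variety `X_Σ` underlying a real point. -/
def Fan.toSpace {n : ℕ} (F : Fan n) : F.Real → F.Space :=
  Quot.map (fun p => ⟨p.1, p.2.toSpec⟩) (by
    rintro ⟨ρ, x⟩ ⟨ρ', y⟩ ⟨z, hx, hy⟩
    refine ⟨z.toSpec, ?_, ?_⟩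
    · rw [RealPoints.toSpec_map, hx]
    · rw [RealPoints.toSpec_map, hy])

/-- `Z` is an irreducible component of the subset `D` of a topological space. -/
def IsComponentOf {X : Type*} [TopologicalSpace X] (Z D : Set X) : Prop :=
  Maximal (fun A : Set X => IsIrreducible A ∧ A ⊆ D) Z

/-- For `σ ∈ Σ` and `S ⊆ U_σ(ℝ)`, the embedding `U_σ ⊆ X_Σ` is compatible with `S`: for every
irreducible component `Z` of `X_Σ ∖ U_σ`, the set `Z(ℝ) ∩ closure S`, with the closure taken in
`X_Σ(ℝ)` in the Euclidean topology, is either empty or Zariski-dense in `Z`. -/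
def Fan.IsCompatible {n : ℕ} (F : Fan n) {σ : Cone n} (hσ : σ ∈ F.cones)
    (S : Set (RealPoints σ)) : Prop :=
  ∀ Z : Set F.Space, IsComponentOf Z (Set.range (F.chart hσ))ᶜ →
    (F.toSpace ⁻¹' Z ∩ closure (F.realChart hσ '' S) = ∅ ∨
      Z ⊆ closure (F.toSpace '' (F.toSpace ⁻¹' Z ∩ closure (F.realChart hσ '' S))))

/-- `U_σ` admits a toric completion that is compatible with `S`: a complete fan containing `σ`
whose toric variety is compatible with `S`. -/
def HasCompatibleToricCompletion {n : ℕ} (σ : Cone n) (S : Set (RealPoints σ)) : Prop :=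
  ∃ (F : Fan n) (hσ : σ ∈ F.cones), F.IsComplete ∧ F.IsCompatible hσ S

end

end Toric

/-!
Each ray `ρ = ℝ₊ u` of the fan `Σ` outside `σ` has a prime divisor `Z_u` of `X_Σ`, and these
divisors are the irreducible components of `X_Σ ∖ U_σ`. The order of `f = ∑ c_m χ^m` along `Z_u`
is the minimum of `⟨m, u⟩` over the characters `m` in `f`. Two facts about those `u` for which
`Z_u` meets the closure of `S` prove the theorem.

* *Poles do not cancel* (`Fan.le_pairing_of_sum`). By compatibility the closure of `S` is then
  Zariski-dense in `Z_u`. Divide functions `f_i ≥ 0` on `S` by a character `χ^{m₀}` of their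
  largest pole order. Near a point of `Z_u` in the closure of `S` the quotients have a common sign
  on `S`, so that their restrictions to `Z_u` cannot cancel at that point without all being zero
  there; by density they do not cancel at all. Hence the `f_i` have no larger pole orders than
  their sum.

* *Characters without poles along these divisors are bounded* (`Fan.IsComplete.chi_bounded`). By
  completeness, an ultrafilter of points of the torus in `S` converges to a real point `p` of some
  chart `U_τ`. The rays of `τ` whose divisors contain `p` lie in `σ` or have divisors meeting the
  closure of `S`, so that such a character is regular at `p`. As the torus is dense in `U_σ(ℝ)`
  (`dense_torus`) and `S` is the closure of its interior, this bounds the character on all of `S`.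

By the second fact and `B_V(S) = ℝ`, the only character in `H_σ` that is nonnegative on all these
`u` is `0`. Dickson's lemma (`finite_of_recession`) then shows that only finitely many characters
in `H_σ` have pole orders at most `d` along all these divisors. By the first fact, if the `f_i`
have a sum in a given finite-dimensional space `U`, with `d` bounding the pole orders in `U`, then
they lie in the span of these finitely many characters.

The geometry of `X_Σ` enters through two results. A pointed rational cone is generated by lattice
vectors spanning faces of it (`exists_face_generators`). Faces correspond to localizations at a
character (`CutsOut.isLocalization`), so that the gluing relations are equivalence relations and
the charts are open maps (`IsGluingSystem`).
-/

open scoped BigOperators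

namespace Toric

noncomputable section

/-- The inclusion `N = ℤⁿ ⊆ N_ℝ = ℝⁿ`. -/
def latticeVec {n : ℕ} (v : Fin n → ℤ) : Fin n → ℝ := fun i => (v i : ℝ)

/-! ### The pairing of characters with vectors -/

section Pairing

variable {n : ℕ}

lemma pairing_zero_left (u : Fin n → ℝ) : pairing 0 u = 0 := by simp [pairing]

lemma pairing_add_left (a b : Fin n → ℤ) (u : Fin n → ℝ) :
    pairing (a + b) u = pairing a u + pairing b u := by
  simp [pairing, add_mul, Finset.sum_add_distrib]

lemma pairing_neg_left (a : Fin n → ℤ) (u : Fin n → ℝ) : pairing (-a) u = -pairing a u := by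
  simp [pairing]

lemma pairing_sub_left (a b : Fin n → ℤ) (u : Fin n → ℝ) :
    pairing (a - b) u = pairing a u - pairing b u := by
  rw [sub_eq_add_neg, pairing_add_left, pairing_neg_left, sub_eq_add_neg]

lemma pairing_nsmul_left (k : ℕ) (a : Fin n → ℤ) (u : Fin n → ℝ) :
    pairing (k • a) u = k * pairing a u := by
  simp [pairing, Finset.mul_sum, mul_assoc]

lemma pairing_sum_left {ι : Type*} (s : Finset ι) (a : ι → Fin n → ℤ) (u : Fin n → ℝ) :
    pairing (∑ i ∈ s, a i) u = ∑ i ∈ s, pairing (a i) u := by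
  classical
  induction s using Finset.induction_on with
  | empty => simp [pairing_zero_left]
  | insert i s hi ih => rw [Finset.sum_insert hi, Finset.sum_insert hi, pairing_add_left, ih]

lemma pairing_zero_right (m : Fin n → ℤ) : pairing m 0 = 0 := by simp [pairing]

lemma pairing_add_right (m : Fin n → ℤ) (u v : Fin n → ℝ) :
    pairing m (u + v) = pairing m u + pairing m v := by
  simp [pairing, mul_add, Finset.sum_add_distrib]

lemma pairing_smul_right (m : Fin n → ℤ) (c : ℝ) (u : Fin n → ℝ) :
    pairing m (c • u) = c * pairing m u := by
  simp [pairing, Finset.mul_sum, mul_left_comm]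

lemma pairing_sum_right {ι : Type*} (s : Finset ι) (m : Fin n → ℤ) (u : ι → Fin n → ℝ) :
    pairing m (∑ i ∈ s, u i) = ∑ i ∈ s, pairing m (u i) := by
  classical
  induction s using Finset.induction_on with
  | empty => simp [pairing_zero_right]
  | insert i s hi ih => rw [Finset.sum_insert hi, Finset.sum_insert hi, pairing_add_right, ih]

lemma pairing_latticeVec (m v : Fin n → ℤ) :
    pairing m (latticeVec v) = ((∑ i, m i * v i : ℤ) : ℝ) := by
  simp [pairing, latticeVec]

lemma latticeVec_ne_zero {v : Fin n → ℤ} (hv : v ≠ 0) : latticeVec v ≠ 0 := by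
  contrapose! hv
  ext i
  have h := congrFun hv i
  simpa [latticeVec] using h

end Pairing

/-! ### Rational cones and their extreme rays -/

section Cones

variable {n : ℕ}

/-- The cone generated by a finite set of lattice vectors. -/
abbrev coneOf (G : Finset (Fin n → ℤ)) : Cone n :=
  PointedCone.hull ℝ (latticeVec '' (G : Set (Fin n → ℤ)))

lemma isRational_iff {σ : Cone n} : IsRational σ ↔ ∃ G, σ = coneOf G := Iff.rfl

lemma latticeVec_mem_coneOf {G : Finset (Fin n → ℤ)} {g : Fin n → ℤ} (hg : g ∈ G) :
    latticeVec g ∈ coneOf G :=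
  Submodule.subset_span ⟨g, hg, rfl⟩

lemma mem_dualMonoid_coneOf {G : Finset (Fin n → ℤ)} {m : Fin n → ℤ} :
    m ∈ dualMonoid (coneOf G) ↔ ∀ g ∈ G, 0 ≤ pairing m (latticeVec g) := by
  refine ⟨fun h g hg => h _ (latticeVec_mem_coneOf hg), fun h u hu => ?_⟩
  induction hu using Submodule.span_induction with
  | mem x hx => obtain ⟨g, hg, rfl⟩ := hx; exact h g hg
  | zero => rw [pairing_zero_right]
  | add x y _ _ hx hy => rw [pairing_add_right]; exact add_nonneg hx hy
  | smul c x _ hx =>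
    have : pairing m (c • x) = (c : ℝ) * pairing m x := pairing_smul_right m c x
    rw [this]; exact mul_nonneg c.2 hx

/-- The ray `ℝ₊ u` spanned by a lattice vector `u`. -/
abbrev ray (u : Fin n → ℤ) : Cone n := PointedCone.hull ℝ {latticeVec u}

lemma mem_ray {u : Fin n → ℤ} {x : Fin n → ℝ} :
    x ∈ ray u ↔ ∃ c : ℝ, 0 ≤ c ∧ x = c • latticeVec u := by
  rw [Submodule.mem_span_singleton]
  constructor
  · rintro ⟨c, rfl⟩
    exact ⟨c, c.2, rfl⟩
  · rintro ⟨c, hc, rfl⟩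
    exact ⟨⟨c, hc⟩, rfl⟩

lemma latticeVec_mem_ray (u : Fin n → ℤ) : latticeVec u ∈ ray u :=
  Submodule.mem_span_singleton_self _

lemma mem_dualMonoid_ray {u m : Fin n → ℤ} :
    m ∈ dualMonoid (ray u) ↔ 0 ≤ pairing m (latticeVec u) := by
  refine ⟨fun h => h _ (latticeVec_mem_ray u), fun h x hx => ?_⟩
  obtain ⟨c, hc, rfl⟩ := mem_ray.1 hx
  rw [pairing_smul_right]
  exact mul_nonneg hc h

lemma ray_le {u : Fin n → ℤ} {τ : Cone n} : ray u ≤ τ ↔ latticeVec u ∈ τ := by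
  rw [Submodule.span_le, Set.singleton_subset_iff]; rfl

lemma smul_mem_cone {τ : Cone n} {c : ℝ} (hc : 0 ≤ c) {x : Fin n → ℝ} (hx : x ∈ τ) :
    c • x ∈ τ :=
  τ.smul_mem hc hx

lemma ray_eq_of_mem {u v : Fin n → ℤ} (hv : v ≠ 0) (h : latticeVec v ∈ ray u) :
    ray v = ray u := by
  obtain ⟨c, hc, hvc⟩ := mem_ray.1 h
  have hc' : 0 < c := by
    refine lt_of_le_of_ne hc fun h0 => latticeVec_ne_zero hv ?_
    rw [hvc, ← h0, zero_smul]
  refine le_antisymm (ray_le.2 h) (ray_le.2 (mem_ray.2 ⟨c⁻¹, (inv_pos.2 hc').le, ?_⟩))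
  rw [hvc, smul_smul, inv_mul_cancel₀ hc'.ne', one_smul]

lemma convex_cone (τ : Cone n) : Convex ℝ (τ : Set (Fin n → ℝ)) := by
  intro x hx y hy a b ha hb _
  exact τ.add_mem (smul_mem_cone ha hx) (smul_mem_cone hb hy)

/-- If a finite set of lattice vectors is strictly positive for a real functional vanishing on the
lattice vector `g ≠ 0`, then it is so for an integral functional vanishing on `g`: the
hyperplane `g^⊥` is rational, so that its rational points are dense. -/
lemma exists_integral_functional {g : Fin n → ℤ} (hg : g ≠ 0) (G : Finset (Fin n → ℤ))
    (w : Fin n → ℝ) (hw : ∑ i, w i * g i = 0) (hpos : ∀ h ∈ G, 0 < ∑ i, w i * (h i : ℝ)) :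
    ∃ m : Fin n → ℤ, pairing m (latticeVec g) = 0 ∧
      ∀ h ∈ G, 0 < pairing m (latticeVec h) := by
  classical
  obtain ⟨j, hj⟩ : ∃ j, g j ≠ 0 := by
    by_contra! h; exact hg (funext h)
  have hjR : (0 : ℝ) < (g j : ℝ) * g j := by
    exact mul_self_pos.2 (by exact_mod_cast hj)
  -- an integral projection onto `g^⊥`, up to the positive factor `(g j)²`
  let φ : (Fin n → ℝ) → (Fin n → ℤ) → ℝ := fun a h =>
    (g j : ℝ) * (g j * ∑ i, a i * (h i : ℝ) - (∑ i, a i * (g i : ℝ)) * h j)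
  have hopen : IsOpen {a : Fin n → ℝ | ∀ h ∈ G, 0 < φ a h} := by
    have : {a : Fin n → ℝ | ∀ h ∈ G, 0 < φ a h} = ⋂ h ∈ G, {a | 0 < φ a h} := by
      ext; simp
    rw [this]
    refine isOpen_biInter_finset fun h _ => isOpen_lt continuous_const ?_
    fun_prop
  have hne : w ∈ {a : Fin n → ℝ | ∀ h ∈ G, 0 < φ a h} := by
    intro h hh
    simp only [φ, hw, zero_mul, sub_zero, ← mul_assoc]
    exact mul_pos hjR (hpos h hh)
  have hdense : DenseRange (Pi.map (fun (_ : Fin n) (q : ℚ) => (q : ℝ))) :=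
    DenseRange.piMap fun _ => Rat.denseRange_cast
  obtain ⟨q, hq⟩ := hdense.exists_mem_open hopen ⟨w, hne⟩
  set D : ℕ := ∏ i, (q i).den with hD
  have hDpos : (0 : ℝ) < D := by
    exact_mod_cast Finset.prod_pos fun i _ => (q i).den_pos
  have hz : ∀ i, ∃ z : ℤ, (z : ℝ) = D * (q i : ℝ) := by
    intro i
    obtain ⟨e, he⟩ : (q i).den ∣ D := Finset.dvd_prod_of_mem _ (Finset.mem_univ i)
    refine ⟨e * (q i).num, ?_⟩
    have h1 : ((q i : ℚ) : ℝ) * (q i).den = (q i).num := by exact_mod_cast Rat.mul_den_eq_num (q i)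
    rw [he]; push_cast; rw [← h1]; ring
  choose z hz using hz
  have hpair : ∀ h : Fin n → ℤ,
      pairing (fun i => g j * (g j * z i - if i = j then ∑ k, z k * g k else 0)) (latticeVec h)
        = D * φ (Pi.map (fun (_ : Fin n) (q : ℚ) => (q : ℝ)) q) h := by
    intro h
    have e1 : ∀ k : Fin n → ℤ, ∑ i, (z i : ℝ) * k i = D * ∑ i, (q i : ℝ) * k i := by
      intro k
      rw [Finset.mul_sum]
      exact Finset.sum_congr rfl fun i _ => by rw [hz]; ring
    have e2 : pairing (fun i => g j * (g j * z i - if i = j then ∑ k, z k * g k else 0))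
        (latticeVec h)
        = (g j : ℝ) * (g j * ∑ i, (z i : ℝ) * h i - (∑ k, (z k : ℝ) * g k) * h j) := by
      simp only [pairing, latticeVec]
      push_cast
      have : ∀ i, ((g j : ℝ) * (g j * z i - if i = j then ∑ k, (z k : ℝ) * g k else 0)) * h i
          = (g j : ℝ) * (g j * (z i * h i))
            - if i = j then (g j : ℝ) * ((∑ k, (z k : ℝ) * g k) * h i) else 0 := by
        intro i; split_ifs <;> ring
      simp only [this, Finset.sum_sub_distrib, Finset.sum_ite_eq', Finset.mem_univ, if_true,
        ← Finset.mul_sum]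
      ring
    rw [e2, e1, e1]
    simp only [φ, Pi.map_apply]
    ring
  refine ⟨fun i => g j * (g j * z i - if i = j then ∑ k, z k * g k else 0), ?_, fun h hh => ?_⟩
  · rw [hpair]; simp only [φ]; ring
  · rw [hpair]; exact mul_pos hDpos (hq h hh)

/-- In a pointed cone, `0` is not a convex combination of nonzero vectors: the nonzero elements
of the cone form a convex set. -/
lemma zero_notMem_convexHull {σ : Cone n} (hσ : IsStronglyConvex σ) {K : Set (Fin n → ℝ)}
    (hK : K ⊆ σ) (h0 : (0 : Fin n → ℝ) ∉ K) : (0 : Fin n → ℝ) ∉ convexHull ℝ K := by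
  have hconv : Convex ℝ {x : Fin n → ℝ | x ∈ σ ∧ x ≠ 0} := by
    rintro x ⟨hx, hx0⟩ y ⟨hy, hy0⟩ a b ha hb hab
    refine ⟨convex_cone σ hx hy ha hb hab, fun hsum => ?_⟩
    have h1 : a • x = 0 := by
      refine hσ _ (smul_mem_cone ha hx) ?_
      rw [neg_eq_of_add_eq_zero_right hsum]
      exact smul_mem_cone hb hy
    have ha0 : a = 0 := (smul_eq_zero.1 h1).resolve_right hx0
    rw [ha0, zero_add] at hab
    rw [ha0, hab, zero_smul, one_smul, zero_add] at hsum
    exact hy0 hsum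
  intro h
  have := convexHull_min (t := {x : Fin n → ℝ | x ∈ σ ∧ x ≠ 0})
    (fun x hx => ⟨hK hx, fun e => h0 (e ▸ hx)⟩) hconv h
  exact this.2 rfl

/-- A pointed rational cone is generated by finitely many lattice vectors spanning rays that
are faces of the cone. -/
theorem exists_face_generators {σ : Cone n} (hrat : IsRational σ) (hpt : IsStronglyConvex σ) :
    ∃ G : Finset (Fin n → ℤ), σ = coneOf G ∧ ∀ g ∈ G, g ≠ 0 ∧ IsFace (ray g) σ := by
  classical
  -- a generating set with the smallest number of elements
  obtain ⟨G, hG, hmin⟩ := WellFounded.has_min (measure Finset.card).wf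
    {G : Finset (Fin n → ℤ) | σ = coneOf G} hrat
  refine ⟨G, hG, fun g hg => ?_⟩
  change σ = coneOf G at hG
  have hgσ : latticeVec g ∈ σ := hG ▸ latticeVec_mem_coneOf hg
  have hle : coneOf (G.erase g) ≤ σ := by
    rw [hG]
    exact Submodule.span_mono (Set.image_mono (by simp))
  have hsup : σ = ray g ⊔ coneOf (G.erase g) := by
    rw [hG, coneOf, coneOf, ← Submodule.span_union, ← Set.image_singleton, ← Set.image_union]
    congr 2
    ext x; simp only [Finset.mem_coe, Finset.coe_erase, Set.mem_union, Set.mem_singleton_iff,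
      Set.mem_sdiff]
    by_cases hx : x = g <;> simp [hx, hg]
  have hnot : latticeVec g ∉ coneOf (G.erase g) := by
    intro h
    refine hmin (G.erase g) ?_ (Finset.card_erase_lt_of_mem hg)
    change σ = _
    rw [hsup, sup_eq_right]
    exact ray_le.2 h
  have hg0 : g ≠ 0 := by
    rintro rfl
    apply hnot
    have : latticeVec (0 : Fin n → ℤ) = 0 := by ext; simp [latticeVec]
    rw [this]; exact Submodule.zero_mem _
  have hne0 : ∀ h ∈ G, h ≠ 0 := by
    rintro h hh rfl
    refine hmin (G.erase 0) ?_ (Finset.card_erase_lt_of_mem hh)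
    change σ = _
    have h0 : latticeVec (0 : Fin n → ℤ) = 0 := by ext; simp [latticeVec]
    refine le_antisymm ?_ (hG ▸ Submodule.span_mono (Set.image_mono (by simp)))
    rw [hG]
    refine Submodule.span_le.2 ?_
    rintro _ ⟨x, hx, rfl⟩
    by_cases hx0 : x = 0
    · rw [hx0, h0]; exact Submodule.zero_mem _
    · exact latticeVec_mem_coneOf (Finset.mem_erase.2 ⟨hx0, hx⟩)
  refine ⟨hg0, ?_⟩
  -- separate the convex hull of the other generators from the line `ℝ g`
  set K : Set (Fin n → ℝ) := latticeVec '' (G.erase g : Set (Fin n → ℤ)) with hK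
  have hKcone : convexHull ℝ K ⊆ coneOf (G.erase g) :=
    convexHull_min Submodule.subset_span (convex_cone _)
  have hdisj : Disjoint (convexHull ℝ K)
      ((Submodule.span ℝ {latticeVec g} : Submodule ℝ (Fin n → ℝ)) : Set (Fin n → ℝ)) := by
    rw [Set.disjoint_left]
    intro y hy hyL
    obtain ⟨c, rfl⟩ := Submodule.mem_span_singleton.1 hyL
    have hyc := hKcone hy
    rcases lt_or_ge 0 c with hc | hc
    · apply hnot
      have := smul_mem_cone (inv_pos.2 hc).le hyc
      rwa [smul_smul, inv_mul_cancel₀ hc.ne', one_smul] at this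
    · have h0 : c • latticeVec g = 0 := by
        refine hpt _ (hle hyc) ?_
        rw [← neg_smul]
        exact smul_mem_cone (neg_nonneg.2 hc) hgσ
      rw [h0] at hy
      refine zero_notMem_convexHull hpt (fun x hx => hle (Submodule.subset_span hx)) ?_ hy
      rintro ⟨h, hh, he⟩
      exact latticeVec_ne_zero (hne0 h (Finset.mem_of_mem_erase hh)) he
  obtain ⟨f, s, t, hfs, hst, hft⟩ := geometric_hahn_banach_compact_closed
    (convex_convexHull ℝ K) (((Finset.finite_toSet _).image latticeVec).isCompact_convexHull ℝ)
    (Submodule.convex (Submodule.span ℝ {latticeVec g}))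
    (Submodule.closed_of_finiteDimensional _) hdisj
  have ht0 : t < 0 := by simpa using hft 0 (Submodule.zero_mem _)
  have hfg : f (latticeVec g) = 0 := by
    by_contra hne
    have := hft ((t / f (latticeVec g)) • latticeVec g)
      (Submodule.smul_mem _ _ (Submodule.mem_span_singleton_self _))
    rw [map_smul, smul_eq_mul, div_mul_cancel₀ _ hne] at this
    exact lt_irrefl _ this
  have hfsum : ∀ h : Fin n → ℤ,
      ∑ i, -f (Pi.single i 1) * (h i : ℝ) = -f (latticeVec h) := by
    intro h
    have : latticeVec h = ∑ i, (h i : ℝ) • (Pi.single i 1 : Fin n → ℝ) := by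
      ext k; simp [latticeVec, Finset.sum_apply, Pi.single_apply]
    rw [this, map_sum, ← Finset.sum_neg_distrib]
    exact Finset.sum_congr rfl fun i _ => by rw [map_smul, smul_eq_mul]; ring
  obtain ⟨m, hm0, hmpos⟩ := exists_integral_functional hg0 (G.erase g)
    (fun i => -f (Pi.single i 1)) (by rw [hfsum, hfg, neg_zero]) (fun h hh => by
      rw [hfsum]
      have := hfs _ (subset_convexHull ℝ K ⟨h, hh, rfl⟩)
      linarith)
  refine ⟨m, ?_, fun u => ⟨fun hu => ?_, fun ⟨hu, hmu⟩ => ?_⟩⟩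
  · rw [hG, mem_dualMonoid_coneOf]
    intro h hh
    by_cases hhg : h = g
    · rw [hhg, hm0]
    · exact (hmpos h (Finset.mem_erase.2 ⟨hhg, hh⟩)).le
  · obtain ⟨c, hc, rfl⟩ := mem_ray.1 hu
    exact ⟨smul_mem_cone hc hgσ, by rw [pairing_smul_right, hm0, mul_zero]⟩
  · rw [hsup] at hu
    obtain ⟨x, hx, y, hy, rfl⟩ := Submodule.mem_sup.1 hu
    have hpos : ∀ y ∈ coneOf (G.erase g), 0 ≤ pairing m y ∧ (pairing m y = 0 → y = 0) := by
      intro y hy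
      induction hy using Submodule.span_induction with
      | mem x hx =>
        obtain ⟨h, hh, rfl⟩ := hx
        exact ⟨(hmpos h hh).le, fun e => absurd e (hmpos h hh).ne'⟩
      | zero => exact ⟨(pairing_zero_right m).ge, fun _ => rfl⟩
      | add x y _ _ hx hy =>
        rw [pairing_add_right]
        refine ⟨add_nonneg hx.1 hy.1, fun e => ?_⟩
        rw [hx.2 (by linarith [hx.1, hy.1]), hy.2 (by linarith [hx.1, hy.1]), add_zero]
      | smul c x _ hx =>
        have e : pairing m (c • x) = (c : ℝ) * pairing m x := pairing_smul_right m c x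
        rw [e]
        refine ⟨mul_nonneg c.2 hx.1, fun e => ?_⟩
        rcases mul_eq_zero.1 e with h | h
        · have : c = 0 := Subtype.ext h
          rw [this, zero_smul]
        · rw [hx.2 h, smul_zero]
    obtain ⟨c, hc, rfl⟩ := mem_ray.1 hx
    rw [pairing_add_right, pairing_smul_right, hm0, mul_zero, zero_add] at hmu
    rw [(hpos y hy).2 hmu, add_zero]
    exact hx

/-- A polyhedron in `M_ℝ` whose recession cone contains no nonzero lattice point has only finitely
many lattice points, by Dickson's lemma. -/
theorem finite_of_recession {ι : Type*} [Finite ι] (e : ι → Fin n → ℤ)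
    (hE : ∀ m : Fin n → ℤ, (∀ i, 0 ≤ pairing m (latticeVec (e i))) → m = 0) (d : ℕ) :
    {m : Fin n → ℤ | ∀ i, -(d : ℝ) ≤ pairing m (latticeVec (e i))}.Finite := by
  classical
  by_contra hinf
  let s := {m : Fin n → ℤ | ∀ i, -(d : ℝ) ≤ pairing m (latticeVec (e i))}
  let a : ℕ ↪ s := Set.Infinite.natEmbedding s hinf
  let b : ℕ → ι → ℕ := fun k i => (∑ j, (a k).1 j * e i j + d).toNat
  have hb : ∀ k i, (b k i : ℝ) = pairing (a k).1 (latticeVec (e i)) + d := by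
    intro k i
    have h1 := (a k).2 i
    rw [pairing_latticeVec] at h1
    have h2 : 0 ≤ ∑ j, (a k).1 j * e i j + d := by
      have : -(d : ℤ) ≤ ∑ j, (a k).1 j * e i j := by exact_mod_cast h1
      linarith
    have h3 : ((b k i : ℕ) : ℤ) = ∑ j, (a k).1 j * e i j + d := Int.toNat_of_nonneg h2
    rw [pairing_latticeVec]
    exact_mod_cast h3
  obtain ⟨k, l, hkl, hle⟩ := wellQuasiOrdered_le b
  have h0 : (a l).1 - (a k).1 = 0 := by
    refine hE _ fun i => ?_
    have : (b k i : ℝ) ≤ b l i := by exact_mod_cast hle i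
    rw [hb, hb] at this
    rw [pairing_sub_left]; linarith
  exact hkl.ne (a.injective (Subtype.ext (sub_eq_zero.1 h0).symm))

end Cones

/-! ### Characters and coordinate rings -/

section Characters

variable {n : ℕ} {σ τ : Cone n}

/-- The character `χ^m ∈ ℝ[H_σ]` for `m ∈ H_σ`. -/
abbrev chi (m : dualMonoid σ) : CoordRing σ := AddMonoidAlgebra.single m 1

lemma chi_add (a b : dualMonoid σ) : chi (a + b) = chi a * chi b := by
  rw [chi, chi, chi, AddMonoidAlgebra.single_mul_single, one_mul]

lemma chi_zero : chi (0 : dualMonoid σ) = 1 := rfl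

lemma chi_nsmul (k : ℕ) (a : dualMonoid σ) : chi (k • a) = chi a ^ k := by
  induction k with
  | zero => rw [zero_smul, pow_zero, chi_zero]
  | succ k ih => rw [succ_nsmul, chi_add, ih, pow_succ]

lemma single_eq_smul_chi (m : dualMonoid σ) (c : ℝ) :
    (AddMonoidAlgebra.single m c : CoordRing σ) = c • chi m := by
  rw [chi, AddMonoidAlgebra.smul_single, smul_eq_mul, mul_one]

lemma restrict_single (h : τ ≤ σ) (m : dualMonoid σ) (c : ℝ) :
    restrict h (AddMonoidAlgebra.single m c) =
      AddMonoidAlgebra.single ⟨m.1, dualMonoid_anti h m.2⟩ c := by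
  exact AddMonoidAlgebra.mapDomain_single

lemma inclusion_injective (h : τ ≤ σ) :
    Function.Injective (AddSubmonoid.inclusion (dualMonoid_anti h)) := by
  intro a b hab
  have := congrArg Subtype.val hab
  exact Subtype.ext this

lemma restrict_injective (h : τ ≤ σ) : Function.Injective (restrict h) := by
  exact AddMonoidAlgebra.mapDomain_injective (inclusion_injective h)

lemma coeff_restrict (h : τ ≤ σ) (f : CoordRing σ) (m : dualMonoid σ) :
    (restrict h f).coeff ⟨m.1, dualMonoid_anti h m.2⟩ = f.coeff m :=
  Finsupp.mapDomain_apply (f := AddSubmonoid.inclusion (dualMonoid_anti h))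
    (inclusion_injective h) _ _

lemma exists_coeff_of_coeff_restrict_ne_zero (h : τ ≤ σ) {f : CoordRing σ} {m : dualMonoid τ}
    (hm : (restrict h f).coeff m ≠ 0) : ∃ m' : dualMonoid σ, m'.1 = m.1 ∧ f.coeff m' ≠ 0 := by
  classical
  obtain ⟨m', hm', e⟩ := Finset.mem_image.1 (Finsupp.mapDomain_support
    (f := AddSubmonoid.inclusion (dualMonoid_anti h)) (Finsupp.mem_support_iff.2 hm))
  exact ⟨m', congrArg Subtype.val e, Finsupp.mem_support_iff.1 hm'⟩

/-- A function on `U_τ` all of whose characters are regular on `U_σ` is itself regular there. -/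
lemma exists_restrict_eq (h : τ ≤ σ) {f : CoordRing τ}
    (hf : ∀ m, f.coeff m ≠ 0 → m.1 ∈ dualMonoid σ) : ∃ g : CoordRing σ, restrict h g = f := by
  have hinj := inclusion_injective h
  refine ⟨.ofCoeff (Finsupp.comapDomain _ f.coeff hinj.injOn), ?_⟩
  refine AddMonoidAlgebra.coeff_injective (Finsupp.mapDomain_comapDomain _ hinj _ ?_)
  intro m hm
  exact ⟨⟨m.1, hf m (Finsupp.mem_support_iff.1 hm)⟩, rfl⟩

lemma coordRing_induction {p : CoordRing σ → Prop} (f : CoordRing σ)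
    (hadd : ∀ f g, p f → p g → p (f + g)) (hchi : ∀ (c : ℝ) (m : dualMonoid σ), p (c • chi m)) :
    p f := by
  have key : ∀ f : CoordRing σ, p f ∧ ∀ r : ℝ, p (r • f) := by
    intro f
    induction f using AddMonoidAlgebra.induction_on with
    | of m =>
      refine ⟨?_, fun r => hchi r m⟩
      have := hchi 1 m
      rw [one_smul] at this
      exact this
    | add x y hx hy =>
      refine ⟨hadd _ _ hx.1 hy.1, fun r => ?_⟩
      rw [smul_add]
      exact hadd _ _ (hx.2 r) (hy.2 r)
    | smul r x hx =>
      refine ⟨hx.2 r, fun s => ?_⟩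
      rw [smul_smul]
      exact hx.2 _
  exact (key f).1

lemma coordRing_algHom_ext {B : Type*} [Semiring B] [Algebra ℝ B] {φ ψ : CoordRing σ →ₐ[ℝ] B}
    (h : ∀ m, φ (chi m) = ψ (chi m)) : φ = ψ := by
  refine AlgHom.ext fun f => ?_
  induction f using coordRing_induction with
  | hadd f g hf hg => rw [map_add, map_add, hf, hg]
  | hchi c m => rw [map_smul, map_smul, h]

lemma restrict_comp {ρ : Cone n} (h₁ : ρ ≤ τ) (h₂ : τ ≤ σ) :
    (restrict h₁).comp (restrict h₂) = restrict (h₁.trans h₂) := by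
  refine coordRing_algHom_ext fun m => ?_
  rw [AlgHom.comp_apply, restrict_single, restrict_single, restrict_single]

lemma restrict_self : restrict (le_refl σ) = AlgHom.id ℝ _ := by
  refine coordRing_algHom_ext fun m => ?_
  rw [restrict_single]; rfl

end Characters

/-! ### Real points -/

section RealPoints

variable {n : ℕ} {σ τ : Cone n}

lemma eval_add (f g : CoordRing σ) (x : RealPoints σ) : eval (f + g) x = eval f x + eval g x :=
  map_add (show CoordRing σ →ₐ[ℝ] ℝ from x) f g

lemma eval_mul (f g : CoordRing σ) (x : RealPoints σ) : eval (f * g) x = eval f x * eval g x :=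
  map_mul (show CoordRing σ →ₐ[ℝ] ℝ from x) f g

lemma eval_one (x : RealPoints σ) : eval 1 x = 1 :=
  map_one (show CoordRing σ →ₐ[ℝ] ℝ from x)

lemma eval_smul (c : ℝ) (f : CoordRing σ) (x : RealPoints σ) : eval (c • f) x = c * eval f x :=
  map_smul (show CoordRing σ →ₐ[ℝ] ℝ from x) c f

lemma eval_sum {ι : Type*} (s : Finset ι) (f : ι → CoordRing σ) (x : RealPoints σ) :
    eval (∑ i ∈ s, f i) x = ∑ i ∈ s, eval (f i) x :=
  map_sum (show CoordRing σ →ₐ[ℝ] ℝ from x) f s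

lemma eval_pow (f : CoordRing σ) (k : ℕ) (x : RealPoints σ) : eval (f ^ k) x = eval f x ^ k :=
  map_pow (show CoordRing σ →ₐ[ℝ] ℝ from x) f k

lemma eval_map (h : τ ≤ σ) (f : CoordRing σ) (x : RealPoints τ) :
    eval f (x.map h) = eval (restrict h f) x := rfl

lemma realPoints_ext {x y : RealPoints σ} (h : ∀ m, eval (chi m) x = eval (chi m) y) : x = y := by
  exact coordRing_algHom_ext (φ := (show CoordRing σ →ₐ[ℝ] ℝ from x))
    (ψ := (show CoordRing σ →ₐ[ℝ] ℝ from y)) h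

lemma continuous_eval (f : CoordRing σ) : Continuous (eval f : RealPoints σ → ℝ) :=
  (continuous_apply f).comp continuous_induced_dom

lemma continuous_to_realPoints {X : Type*} [TopologicalSpace X] {φ : X → RealPoints σ}
    (h : ∀ f, Continuous fun x => eval f (φ x)) : Continuous φ :=
  continuous_induced_rng.2 (continuous_pi h)

/-- A family of real points converges if all its characters do. -/
lemma tendsto_realPoints {X : Type*} {l : Filter X} {φ : X → RealPoints σ} {p : RealPoints σ}
    (h : ∀ m, Filter.Tendsto (fun x => eval (chi m) (φ x)) l (nhds (eval (chi m) p))) :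
    Filter.Tendsto φ l (nhds p) := by
  rw [nhds_induced, Filter.tendsto_comap_iff, tendsto_pi_nhds]
  intro f
  change Filter.Tendsto (fun x => eval f (φ x)) l (nhds (eval f p))
  induction f using coordRing_induction with
  | hadd f g hf hg => simp only [eval_add]; exact hf.add hg
  | hchi c m => simp only [eval_smul]; exact (h m).const_mul c

/-- The real point of `U_σ` given by a monoid homomorphism `H_σ → ℝ`. -/
def pointOf (φ : dualMonoid σ → ℝ) (h0 : φ 0 = 1) (hadd : ∀ a b, φ (a + b) = φ a * φ b) :
    RealPoints σ :=
  AddMonoidAlgebra.lift ℝ ℝ (dualMonoid σ)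
    { toFun := fun m => φ m.toAdd, map_one' := h0, map_mul' := fun _ _ => hadd _ _ }

lemma eval_pointOf (φ : dualMonoid σ → ℝ) (h0 : φ 0 = 1) (hadd : ∀ a b, φ (a + b) = φ a * φ b)
    (m : dualMonoid σ) : eval (chi m) (pointOf φ h0 hadd) = φ m := by
  change AddMonoidAlgebra.lift ℝ ℝ (dualMonoid σ) _ _ = _
  rw [AddMonoidAlgebra.lift_single]
  simp

end RealPoints

/-! ### Faces and localizations -/

section Faces

variable {n : ℕ} {σ τ : Cone n}

/-- A large multiple of `a` makes up for the negative values of `m` at the generators at which `a`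
is positive. -/
lemma exists_add_nsmul_mem {G : Finset (Fin n → ℤ)} {a m : Fin n → ℤ}
    (h : ∀ g ∈ G, 0 < pairing a (latticeVec g) ∨
      0 ≤ pairing a (latticeVec g) ∧ 0 ≤ pairing m (latticeVec g)) :
    ∃ k : ℕ, m + k • a ∈ dualMonoid (coneOf G) := by
  have hev : ∀ g ∈ G, ∀ᶠ k : ℕ in Filter.atTop, 0 ≤ pairing (m + k • a) (latticeVec g) := by
    intro g hg
    simp only [pairing_add_left, pairing_nsmul_left]
    rcases h g hg with h | ⟨h1, h2⟩
    · have : Filter.Tendsto (fun k : ℕ => pairing m (latticeVec g) + k * pairing a (latticeVec g))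
          Filter.atTop Filter.atTop :=
        Filter.tendsto_atTop_add_const_left _ _
          (tendsto_natCast_atTop_atTop.atTop_mul_const h)
      exact this.eventually_ge_atTop 0
    · exact Filter.Eventually.of_forall fun k => by positivity
  obtain ⟨k, hk⟩ := ((Filter.eventually_all_finset G).2 hev).exists
  exact ⟨k, mem_dualMonoid_coneOf.2 hk⟩

/-- `m` cuts the face `τ` out of the cone `σ`. -/
def CutsOut (m : dualMonoid σ) (τ : Cone n) : Prop := ∀ u, u ∈ τ ↔ u ∈ σ ∧ pairing m.1 u = 0

lemma CutsOut.le {m : dualMonoid σ} (h : CutsOut m τ) : τ ≤ σ := fun u hu => ((h u).1 hu).1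

lemma CutsOut.inf {a b : dualMonoid σ} {τ₁ τ₂ : Cone n} (ha : CutsOut a τ₁) (hb : CutsOut b τ₂) :
    CutsOut (a + b) (τ₁ ⊓ τ₂) := by
  intro u
  rw [Submodule.mem_inf, ha, hb]
  change _ ↔ _ ∧ pairing (a.1 + b.1) u = 0
  rw [pairing_add_left]
  constructor
  · rintro ⟨⟨h, h1⟩, -, h2⟩
    exact ⟨h, by rw [h1, h2, add_zero]⟩
  · rintro ⟨h, h1⟩
    have := a.2 u h
    have := b.2 u h
    exact ⟨⟨h, by linarith⟩, h, by linarith⟩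

lemma IsFace.exists_cutsOut (h : IsFace τ σ) : ∃ m : dualMonoid σ, CutsOut m τ := by
  obtain ⟨m, hm, h⟩ := h
  exact ⟨⟨m, hm⟩, h⟩

lemma IsFace.le (h : IsFace τ σ) : τ ≤ σ := h.exists_cutsOut.choose_spec.le

lemma CutsOut.neg_mem {m : dualMonoid σ} (h : CutsOut m τ) : -m.1 ∈ dualMonoid τ := by
  intro u hu
  rw [pairing_neg_left, ((h u).1 hu).2, neg_zero]

lemma CutsOut.exists_add_nsmul_mem (hσ : IsRational σ) {m : dualMonoid σ} (h : CutsOut m τ)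
    (a : dualMonoid τ) : ∃ k : ℕ, a.1 + k • m.1 ∈ dualMonoid σ := by
  obtain ⟨G, rfl⟩ := isRational_iff.1 hσ
  refine Toric.exists_add_nsmul_mem fun g hg => ?_
  rcases (m.2 _ (latticeVec_mem_coneOf hg)).lt_or_eq with h1 | h1
  · exact Or.inl h1
  · exact Or.inr ⟨h1.le, a.2 _ ((h _).2 ⟨latticeVec_mem_coneOf hg, h1.symm⟩)⟩

/-- If `m` cuts the face `τ` out of `σ`, then `χ^{-m}` is the inverse of `χ^m` on `U_τ`. -/
lemma CutsOut.mul_inv {m : dualMonoid σ} (h : CutsOut m τ) :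
    restrict h.le (chi m) * chi ⟨-m.1, h.neg_mem⟩ = 1 := by
  rw [restrict_single, AddMonoidAlgebra.single_mul_single, one_mul, AddMonoidAlgebra.one_def]
  congr 1
  exact Subtype.ext (add_neg_cancel m.1)

/-- If `m` cuts the face `τ` out of `σ`, then every `f ∈ ℝ[H_τ]` becomes an element of `ℝ[H_σ]`
after multiplication by a power of `χ^m`. -/
lemma CutsOut.exists_mul_pow (hσ : IsRational σ) {m : dualMonoid σ} (h : CutsOut m τ)
    (f : CoordRing τ) :
    ∃ (k : ℕ) (g : CoordRing σ), f * restrict h.le (chi m) ^ k = restrict h.le g := by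
  induction f using coordRing_induction with
  | hadd f₁ f₂ h₁ h₂ =>
    obtain ⟨k₁, g₁, e₁⟩ := h₁
    obtain ⟨k₂, g₂, e₂⟩ := h₂
    refine ⟨k₁ + k₂, g₁ * chi m ^ k₂ + g₂ * chi m ^ k₁, ?_⟩
    rw [map_add, map_mul, map_mul, map_pow, map_pow, ← e₁, ← e₂]
    ring
  | hchi c a =>
    obtain ⟨k, hk⟩ := h.exists_add_nsmul_mem hσ a
    refine ⟨k, c • chi ⟨_, hk⟩, ?_⟩
    rw [map_smul, smul_mul_assoc, ← map_pow, ← chi_nsmul, restrict_single, restrict_single,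
      AddMonoidAlgebra.single_mul_single, one_mul]
    congr 2

/-- If `m` cuts the face `τ` out of `σ`, then `ℝ[H_τ]` is the localization of `ℝ[H_σ]`
at `χ^m`. -/
theorem CutsOut.isLocalization (hσ : IsRational σ) {m : dualMonoid σ} (h : CutsOut m τ) :
    letI := (restrict h.le).toRingHom.toAlgebra
    IsLocalization.Away (chi m) (CoordRing τ) := by
  let _ := (restrict h.le).toRingHom.toAlgebra
  refine ⟨?_, ?_, ?_⟩
  · rintro ⟨_, k, rfl⟩
    change IsUnit (restrict h.le (chi m ^ k))
    rw [map_pow]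
    exact (IsUnit.of_mul_eq_one _ h.mul_inv).pow k
  · intro f
    obtain ⟨k, g, e⟩ := h.exists_mul_pow hσ f
    refine ⟨⟨g, ⟨_, k, rfl⟩⟩, ?_⟩
    change f * restrict h.le (chi m ^ k) = restrict h.le g
    rw [map_pow, e]
  · intro x y hxy
    exact ⟨1, by rw [restrict_injective h.le hxy]⟩

lemma CutsOut.comap_isOpenEmbedding (hσ : IsRational σ) {m : dualMonoid σ} (h : CutsOut m τ) :
    Topology.IsOpenEmbedding (PrimeSpectrum.comap (restrict h.le).toRingHom) := by
  let _ := (restrict h.le).toRingHom.toAlgebra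
  have := h.isLocalization hσ
  exact PrimeSpectrum.localization_away_isOpenEmbedding (CoordRing τ) (chi m)

lemma CutsOut.mem_range_comap (hσ : IsRational σ) {m : dualMonoid σ} (h : CutsOut m τ)
    {P : PrimeSpectrum (CoordRing σ)} :
    P ∈ Set.range (PrimeSpectrum.comap (restrict h.le).toRingHom) ↔ chi m ∉ P.asIdeal := by
  let _ := (restrict h.le).toRingHom.toAlgebra
  have := h.isLocalization hσ
  exact Set.ext_iff.1 (PrimeSpectrum.localization_away_comap_range (CoordRing τ) (chi m)) P

lemma CutsOut.eval_mul_inv {m : dualMonoid σ} (h : CutsOut m τ) (x : RealPoints τ) :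
    eval (chi m) (x.map h.le) * eval (chi ⟨-m.1, h.neg_mem⟩) x = 1 := by
  rw [eval_map, ← eval_mul, h.mul_inv, eval_one]

lemma CutsOut.mem_range_map (hσ : IsRational σ) {m : dualMonoid σ} (h : CutsOut m τ)
    {x : RealPoints σ} :
    x ∈ Set.range (RealPoints.map h.le) ↔ eval (chi m) x ≠ 0 := by
  constructor
  · rintro ⟨y, rfl⟩ h0
    have := h.eval_mul_inv y
    rw [h0, zero_mul] at this
    exact zero_ne_one this
  · intro hx
    let _ := (restrict h.le).toRingHom.toAlgebra
    have := h.isLocalization hσ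
    have hu : IsUnit ((show CoordRing σ →ₐ[ℝ] ℝ from x).toRingHom (chi m)) :=
      isUnit_iff_ne_zero.2 hx
    let y : CoordRing τ →+* ℝ := IsLocalization.Away.lift (chi m) hu
    have hy : ∀ f, y (restrict h.le f) = eval f x := fun f =>
      IsLocalization.Away.lift_eq (chi m) hu f
    let z : CoordRing τ →ₐ[ℝ] ℝ :=
      { y with
        commutes' := fun r => by
          have h1 := hy (algebraMap ℝ _ r)
          rw [AlgHom.commutes] at h1
          exact h1.trans ((show CoordRing σ →ₐ[ℝ] ℝ from x).commutes r) }
    exact ⟨z, realPoints_ext fun a => hy (chi a)⟩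

lemma CutsOut.map_isOpenEmbedding (hσ : IsRational σ) {m : dualMonoid σ} (h : CutsOut m τ) :
    Topology.IsOpenEmbedding (RealPoints.map h.le) := by
  have hcont : Continuous (RealPoints.map h.le) :=
    continuous_to_realPoints fun f => continuous_eval (restrict h.le f)
  have hformula : ∀ f : CoordRing τ, ∃ (k : ℕ) (g : CoordRing σ), ∀ x : RealPoints τ,
      eval f x = eval g (x.map h.le) / eval (chi m) (x.map h.le) ^ k := by
    intro f
    obtain ⟨k, g, e⟩ := h.exists_mul_pow hσ f
    refine ⟨k, g, fun x => ?_⟩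
    rw [eq_div_iff (pow_ne_zero _ ((h.mem_range_map hσ).1 ⟨x, rfl⟩)), eval_map, eval_map, ← e,
      eval_mul, eval_pow]
  refine ⟨⟨Topology.isInducing_iff_nhds.2 fun x => le_antisymm ?_ ?_, ?_⟩, ?_⟩
  · exact Filter.tendsto_iff_comap.1 (hcont.tendsto x)
  · refine Filter.tendsto_id'.1 (tendsto_realPoints fun a => ?_)
    obtain ⟨k, g, e⟩ := hformula (chi a)
    simp only [id, e]
    refine Filter.Tendsto.div ?_ ?_ (pow_ne_zero _ ((h.mem_range_map hσ).1 ⟨x, rfl⟩))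
    · exact ((continuous_eval g).tendsto _).comp Filter.tendsto_comap
    · exact (((continuous_eval (chi m)).tendsto _).comp Filter.tendsto_comap).pow k
  · intro x y hxy
    refine realPoints_ext fun a => ?_
    obtain ⟨k, g, e⟩ := hformula (chi a)
    rw [e, e, hxy]
  · have : Set.range (RealPoints.map h.le) = eval (chi m) ⁻¹' {0}ᶜ := by
      ext x; exact h.mem_range_map hσ
    rw [this]
    exact isOpen_compl_singleton.preimage (continuous_eval _)

end Faces

/-! ### Gluing along a fan -/

section Gluing

variable {n : ℕ}

/-- Data from which a space is glued along a fan `F` as a toric variety is: a space `Y σ` for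
every cone `σ` and transition maps `Y τ → Y σ` for `τ ≤ σ`, which are functorial, open embeddings
for faces, and such that the images of two faces meet in the image of their intersection. -/
structure IsGluingSystem (F : Fan n) (Y : Cone n → Type) [∀ σ, TopologicalSpace (Y σ)]
    (φ : ∀ ⦃τ σ : Cone n⦄, τ ≤ σ → Y τ → Y σ) : Prop where
  comp : ∀ {a b c : Cone n} (h₁ : a ≤ b) (h₂ : b ≤ c) (y : Y a),
    φ h₂ (φ h₁ y) = φ (h₁.trans h₂) y
  self : ∀ {a : Cone n} (y : Y a), φ le_rfl y = y
  isOpenEmbedding : ∀ σ ∈ F.cones, ∀ τ (h : τ ≤ σ), IsFace τ σ → Topology.IsOpenEmbedding (φ h)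
  inter : ∀ σ ∈ F.cones, ∀ a b (ha : a ≤ σ) (hb : b ≤ σ), IsFace a σ → IsFace b σ →
    ∀ (x : Y a) (y : Y b), φ ha x = φ hb y →
      ∃ z : Y (a ⊓ b), φ (inf_le_left.trans ha) z = φ ha x

namespace IsGluingSystem

variable {F : Fan n} {Y : Cone n → Type} [∀ σ, TopologicalSpace (Y σ)]
  {φ : ∀ ⦃τ σ : Cone n⦄, τ ≤ σ → Y τ → Y σ}

/-- The gluing relation: two points of the disjoint union are identified if they come from a point
over the intersection of their cones. -/
def Rel (φ : ∀ ⦃τ σ : Cone n⦄, τ ≤ σ → Y τ → Y σ) (p q : Σ ρ : {ρ // ρ ∈ F.cones}, Y ρ.1) : Prop :=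
  ∃ z : Y (p.1.1 ⊓ q.1.1), φ inf_le_left z = p.2 ∧ φ inf_le_right z = q.2

theorem rel_equivalence (H : IsGluingSystem F Y φ) :
    Equivalence (Rel φ : (Σ ρ : {ρ // ρ ∈ F.cones}, Y ρ.1) → _ → Prop) := by
  refine ⟨fun p => ?_, fun {p q} h => ?_, fun {p q r} hpq hqr => ?_⟩
  · exact ⟨φ (le_inf le_rfl le_rfl) p.2, by rw [H.comp, H.self], by rw [H.comp, H.self]⟩
  · obtain ⟨z, h₁, h₂⟩ := h
    exact ⟨φ (le_inf inf_le_right inf_le_left) z, by rw [H.comp, h₂], by rw [H.comp, h₁]⟩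
  · obtain ⟨x, hx₁, hx₂⟩ := hpq
    obtain ⟨y, hy₁, hy₂⟩ := hqr
    -- `q` lies over the intersection of all three cones
    have hfx := (F.inter_face _ p.1.2 _ q.1.2).2
    have hfy := (F.inter_face _ q.1.2 _ r.1.2).1
    obtain ⟨z, hz⟩ := H.inter _ q.1.2 _ _ inf_le_right inf_le_left hfx hfy x y (hx₂.trans hy₁.symm)
    have hzx : φ inf_le_left z = x :=
      (H.isOpenEmbedding _ q.1.2 _ inf_le_right hfx).injective (by rw [H.comp, hz])
    have hzy : φ inf_le_right z = y :=
      (H.isOpenEmbedding _ q.1.2 _ inf_le_left hfy).injective (by rw [H.comp, hz, hx₂, hy₁])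
    refine ⟨φ (le_inf (inf_le_left.trans inf_le_left) (inf_le_right.trans inf_le_right)) z, ?_, ?_⟩
    · rw [H.comp, ← hx₁, ← hzx, H.comp]
    · rw [H.comp, ← hy₂, ← hzy, H.comp]

theorem mk_eq_iff (H : IsGluingSystem F Y φ) {p q : Σ ρ : {ρ // ρ ∈ F.cones}, Y ρ.1} :
    Quot.mk (Rel φ) p = Quot.mk (Rel φ) q ↔ Rel φ p q := by
  rw [Quot.eq, H.rel_equivalence.eqvGen_iff]

/-- The charts of a space glued along a fan are open maps. -/
theorem isOpenMap_chart (H : IsGluingSystem F Y φ) {σ : Cone n} (hσ : σ ∈ F.cones) :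
    IsOpenMap fun y : Y σ =>
      Quot.mk (Rel φ) (⟨⟨σ, hσ⟩, y⟩ : Σ ρ : {ρ // ρ ∈ F.cones}, Y ρ.1) := by
  intro W hW
  rw [isOpen_coinduced, isOpen_sigma_iff]
  rintro ⟨τ, hτ⟩
  have hfτ := (F.inter_face _ hτ _ hσ).1
  have hfσ := (F.inter_face _ hτ _ hσ).2
  have : (Sigma.mk (⟨τ, hτ⟩ : {ρ // ρ ∈ F.cones})) ⁻¹' (Quot.mk (Rel φ) ⁻¹'
      ((fun y : Y σ => Quot.mk (Rel φ) (⟨⟨σ, hσ⟩, y⟩ : Σ ρ : {ρ // ρ ∈ F.cones}, Y ρ.1)) '' W))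
      = φ (inf_le_left : τ ⊓ σ ≤ τ) '' (φ (inf_le_right : τ ⊓ σ ≤ σ) ⁻¹' W) := by
    ext y
    constructor
    · rintro ⟨w, hw, e⟩
      obtain ⟨z, h₁, h₂⟩ := H.mk_eq_iff.1 e.symm
      refine ⟨z, ?_, h₁⟩
      change φ _ z ∈ W
      rw [show φ _ z = w from h₂]
      exact hw
    · rintro ⟨z, hz, rfl⟩
      exact ⟨_, hz, (H.mk_eq_iff.2 ⟨z, rfl, rfl⟩).symm⟩
  rw [this]
  exact (H.isOpenEmbedding _ hτ _ _ hfτ).isOpenMap _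
    (hW.preimage (H.isOpenEmbedding _ hσ _ _ hfσ).continuous)

end IsGluingSystem

variable (F : Fan n)

theorem isGluingSystem_spec : IsGluingSystem F (fun σ => PrimeSpectrum (CoordRing σ))
    fun _ _ h => PrimeSpectrum.comap (restrict h).toRingHom where
  comp h₁ h₂ y := by
    rw [← restrict_comp h₁ h₂]; rfl
  self y := by
    rw [restrict_self]; rfl
  isOpenEmbedding σ hσ τ _ hf := by
    obtain ⟨m, hm⟩ := hf.exists_cutsOut
    exact hm.comap_isOpenEmbedding (F.rational σ hσ)
  inter σ hσ a b _ _ hfa hfb x y hxy := by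
    obtain ⟨m, hm⟩ := hfa.exists_cutsOut
    obtain ⟨m', hm'⟩ := hfb.exists_cutsOut
    have hσr := F.rational σ hσ
    refine ((hm.inf hm').mem_range_comap hσr).2 ?_
    rw [chi_add]
    intro hmem
    rcases (PrimeSpectrum.isPrime _).mem_or_mem hmem with h | h
    · exact (hm.mem_range_comap hσr).1 ⟨x, rfl⟩ h
    · exact (hm'.mem_range_comap hσr).1 ⟨y, hxy.symm⟩ h

theorem isGluingSystem_real : IsGluingSystem F RealPoints fun _ _ h => RealPoints.map h where
  comp h₁ h₂ y := by
    refine realPoints_ext fun m => ?_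
    rw [eval_map, eval_map, eval_map, ← restrict_comp h₁ h₂]; rfl
  self y := by
    refine realPoints_ext fun m => ?_
    rw [eval_map, restrict_self]; rfl
  isOpenEmbedding σ hσ τ _ hf := by
    obtain ⟨m, hm⟩ := hf.exists_cutsOut
    exact hm.map_isOpenEmbedding (F.rational σ hσ)
  inter σ hσ a b _ _ hfa hfb x y hxy := by
    obtain ⟨m, hm⟩ := hfa.exists_cutsOut
    obtain ⟨m', hm'⟩ := hfb.exists_cutsOut
    have hσr := F.rational σ hσ
    refine ((hm.inf hm').mem_range_map hσr).2 ?_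
    rw [chi_add, eval_mul]
    refine mul_ne_zero ((hm.mem_range_map hσr).1 ⟨x, rfl⟩) ?_
    exact (hm'.mem_range_map hσr).1 ⟨y, hxy.symm⟩

variable {F} {σ τ : Cone n} (hσ : σ ∈ F.cones) (hτ : τ ∈ F.cones)

lemma Fan.chart_eq_iff {p : PrimeSpectrum (CoordRing σ)} {q : PrimeSpectrum (CoordRing τ)} :
    F.chart hσ p = F.chart hτ q ↔ F.SpaceRel ⟨⟨σ, hσ⟩, p⟩ ⟨⟨τ, hτ⟩, q⟩ :=
  (isGluingSystem_spec F).mk_eq_iff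

lemma Fan.isOpenMap_chart : IsOpenMap (F.chart hσ) := (isGluingSystem_spec F).isOpenMap_chart hσ

lemma Fan.continuous_chart : Continuous (F.chart hσ) :=
  continuous_quot_mk.comp (continuous_sigmaMk (σ := fun ρ : {ρ // ρ ∈ F.cones} =>
    PrimeSpectrum (CoordRing ρ.1)) (i := ⟨σ, hσ⟩))

lemma Fan.realChart_eq_iff {x : RealPoints σ} {y : RealPoints τ} :
    F.realChart hσ x = F.realChart hτ y ↔ F.RealRel ⟨⟨σ, hσ⟩, x⟩ ⟨⟨τ, hτ⟩, y⟩ :=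
  (isGluingSystem_real F).mk_eq_iff

lemma Fan.isOpenMap_realChart : IsOpenMap (F.realChart hσ) :=
  (isGluingSystem_real F).isOpenMap_chart hσ

lemma Fan.continuous_realChart : Continuous (F.realChart hσ) :=
  continuous_quot_mk.comp (continuous_sigmaMk (σ := fun ρ : {ρ // ρ ∈ F.cones} =>
    RealPoints ρ.1) (i := ⟨σ, hσ⟩))

/-- A real point of `X_Σ` lies in `U_σ(ℝ)` as soon as its underlying point lies in `U_σ`. -/
lemma Fan.exists_realChart_of_toSpace {p : F.Real} {P : PrimeSpectrum (CoordRing σ)}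
    (h : F.toSpace p = F.chart hσ P) : ∃ x : RealPoints σ, p = F.realChart hσ x := by
  obtain ⟨⟨⟨τ, hτ⟩, x⟩, rfl⟩ := Quot.exists_rep p
  obtain ⟨z, hz, -⟩ := (F.chart_eq_iff hτ hσ).1 h
  obtain ⟨m, hm⟩ := (F.inter_face τ hτ σ hσ).1.exists_cutsOut
  obtain ⟨y, rfl⟩ := (hm.mem_range_map (F.rational τ hτ)).2
    ((hm.mem_range_comap (F.rational τ hτ)).1 ⟨z, hz⟩)
  exact ⟨y.map inf_le_right, (F.realChart_eq_iff hτ hσ).2 ⟨y, rfl, rfl⟩⟩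

end Gluing

/-! ### Characters not vanishing at a point -/

section UnitFace

variable {n : ℕ} {σ : Cone n}

/-- The face of the monoid `H_σ` that consists of the characters not vanishing at the point `P`
of `U_σ`. It determines the torus orbit of `P`. -/
def unitFace (P : PrimeSpectrum (CoordRing σ)) : AddSubmonoid (dualMonoid σ) where
  carrier := {m | chi m ∉ P.asIdeal}
  zero_mem' := (Ideal.ne_top_iff_one _).1 P.isPrime.ne_top
  add_mem' := by
    intro a b ha hb
    change chi (a + b) ∉ P.asIdeal
    rw [chi_add]
    exact P.isPrime.mul_notMem ha hb

lemma mem_unitFace {P : PrimeSpectrum (CoordRing σ)} {m : dualMonoid σ} :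
    m ∈ unitFace P ↔ chi m ∉ P.asIdeal := Iff.rfl

/-- `u` is orthogonal to the face `unitFace P` of `H_σ`. For a generator `u` of an extreme ray of
`σ`, this means that `P` lies in the divisor of that ray. -/
def IsOrth (P : PrimeSpectrum (CoordRing σ)) (u : Fin n → ℤ) : Prop :=
  ∀ b ∈ unitFace P, pairing b.1 (latticeVec u) = 0

/-- A character that is nonnegative on the generators of `σ` orthogonal to `unitFace P` is
regular at `P`, being a quotient of a regular function by one that does not vanish at `P`. -/
lemma exists_add_mem {G : Finset (Fin n → ℤ)} (hG : σ = coneOf G)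
    (P : PrimeSpectrum (CoordRing σ)) {m : Fin n → ℤ}
    (hm : ∀ g ∈ G, IsOrth P g → 0 ≤ pairing m (latticeVec g)) :
    ∃ c ∈ unitFace P, m + c.1 ∈ dualMonoid σ := by
  classical
  have hex : ∀ g : Fin n → ℤ, ∃ a ∈ unitFace P,
      ¬ IsOrth P g → pairing a.1 (latticeVec g) ≠ 0 := by
    intro g
    by_cases h : IsOrth P g
    · exact ⟨0, zero_mem _, fun h' => absurd h h'⟩
    · unfold IsOrth at h
      push Not at h
      obtain ⟨b, hb, hne⟩ := h
      exact ⟨b, hb, fun _ => hne⟩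
  choose a ha hpos using hex
  -- the sum of the `a g` is positive on all generators that are not orthogonal to the face
  have hsum : ∑ g ∈ G, a g ∈ unitFace P := sum_mem fun g _ => ha g
  have hge : ∀ b : dualMonoid σ, ∀ g ∈ G, 0 ≤ pairing b.1 (latticeVec g) := fun b g hg =>
    b.2 _ (hG ▸ latticeVec_mem_coneOf hg)
  have hcoe : (∑ g ∈ G, a g).1 = ∑ g ∈ G, (a g).1 := by
    rw [AddSubmonoid.coe_finsetSum]
  obtain ⟨k, hk⟩ := exists_add_nsmul_mem (G := G) (a := (∑ g ∈ G, a g).1) (m := m) (by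
    intro g hg
    by_cases h : IsOrth P g
    · exact Or.inr ⟨hge _ g hg, hm g hg h⟩
    · left
      rw [hcoe, pairing_sum_left]
      exact Finset.sum_pos' (fun i _ => hge _ g hg)
        ⟨g, hg, lt_of_le_of_ne (hge _ g hg) (hpos g h).symm⟩)
  refine ⟨k • ∑ g ∈ G, a g, nsmul_mem hsum k, ?_⟩
  rw [← hG] at hk
  exact hk

/-- The face `unitFace P` is cut out of `H_σ` by the generators of `σ` orthogonal to it. -/
lemma mem_unitFace_of_orth {G : Finset (Fin n → ℤ)} (hG : σ = coneOf G)
    (P : PrimeSpectrum (CoordRing σ)) (m : dualMonoid σ)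
    (hm : ∀ g ∈ G, IsOrth P g → pairing m.1 (latticeVec g) = 0) : m ∈ unitFace P := by
  obtain ⟨c, hc, hmem⟩ := exists_add_mem hG P (m := -m.1) fun g hg h => by
    rw [pairing_neg_left, hm g hg h, neg_zero]
  have h : c = m + ⟨-m.1 + c.1, hmem⟩ := Subtype.ext (by simp)
  rw [mem_unitFace, h, chi_add] at hc
  exact fun h' => hc (P.asIdeal.mul_mem_right _ h')

end UnitFace

/-! ### The generic point of the divisor of a ray -/

section GenericPoint

variable {n : ℕ}

/-- The restriction of regular functions on `U_ρ`, for a ray `ρ = ℝ₊ u`, to the divisor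
`U_ρ ∖ T`, with values in the group ring of `M`: it maps `χ^m` to itself if `⟨m, u⟩ = 0`, and to
`0` otherwise. -/
def toDivisor (u : Fin n → ℤ) :
    CoordRing (ray u) →ₐ[ℝ] AddMonoidAlgebra ℝ (Fin n → ℤ) :=
  open Classical in
  AddMonoidAlgebra.lift ℝ _ (dualMonoid (ray u))
    { toFun := fun m => if pairing m.toAdd.1 (latticeVec u) = 0
        then AddMonoidAlgebra.single m.toAdd.1 1 else 0
      map_one' := by
        change (if pairing 0 (latticeVec u) = 0 then AddMonoidAlgebra.single 0 1 else 0) = _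
        rw [if_pos (pairing_zero_left _)]; rfl
      map_mul' := by
        intro a b
        have ha := mem_dualMonoid_ray.1 a.toAdd.2
        have hb := mem_dualMonoid_ray.1 b.toAdd.2
        change (if pairing (a.toAdd.1 + b.toAdd.1) (latticeVec u) = 0 then
          AddMonoidAlgebra.single (a.toAdd.1 + b.toAdd.1) 1 else 0) = _
        rw [pairing_add_left]
        by_cases h1 : pairing a.toAdd.1 (latticeVec u) = 0
        · by_cases h2 : pairing b.toAdd.1 (latticeVec u) = 0
          · rw [if_pos h1, if_pos h2, if_pos (by rw [h1, h2, add_zero]),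
              AddMonoidAlgebra.single_mul_single, one_mul]
          · rw [if_neg h2, mul_zero, if_neg (by rwa [h1, zero_add])]
        · rw [if_neg h1, zero_mul, if_neg]
          exact fun h => h1 (by linarith) }

open Classical in
lemma toDivisor_chi (u : Fin n → ℤ) (m : dualMonoid (ray u)) :
    toDivisor u (chi m) = if pairing m.1 (latticeVec u) = 0
        then AddMonoidAlgebra.single m.1 1 else 0 := by
  rw [toDivisor, AddMonoidAlgebra.lift_single, one_smul]
  rfl

open Classical in
lemma coeff_toDivisor (u : Fin n → ℤ) (f : CoordRing (ray u)) (m : dualMonoid (ray u)) :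
    (toDivisor u f).coeff m.1 =
      if pairing m.1 (latticeVec u) = 0 then f.coeff m else 0 := by
  induction f using coordRing_induction with
  | hadd f g hf hg =>
    rw [map_add, AddMonoidAlgebra.coeff_add, AddMonoidAlgebra.coeff_add, Finsupp.add_apply,
      Finsupp.add_apply, hf, hg]
    split_ifs <;> simp
  | hchi c a =>
    rw [map_smul, toDivisor_chi, AddMonoidAlgebra.coeff_smul, AddMonoidAlgebra.coeff_smul,
      Finsupp.smul_apply, Finsupp.smul_apply, AddMonoidAlgebra.coeff_single]
    by_cases hma : m = a
    · subst hma
      split_ifs <;> simp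
    · have hma' : a.1 ≠ m.1 := fun h => hma (Subtype.ext h.symm)
      rw [Finsupp.single_eq_of_ne hma]
      split_ifs <;> simp [AddMonoidAlgebra.coeff_single, hma']

lemma coeff_toDivisor_of_notMem (u : Fin n → ℤ) (f : CoordRing (ray u)) {m : Fin n → ℤ}
    (hm : pairing m (latticeVec u) ≠ 0) : (toDivisor u f).coeff m = 0 := by
  classical
  induction f using coordRing_induction with
  | hadd f g hf hg =>
    rw [map_add, AddMonoidAlgebra.coeff_add, Finsupp.add_apply, hf, hg, add_zero]
  | hchi c a =>
    rw [map_smul, toDivisor_chi, AddMonoidAlgebra.coeff_smul, Finsupp.smul_apply]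
    split_ifs with h
    · have : a.1 ≠ m := by rintro rfl; exact hm h
      simp [AddMonoidAlgebra.coeff_single, this]
    · simp

/-- The generic point of the divisor `U_ρ ∖ T` of `U_ρ`, for the ray `ρ` spanned by `u`. -/
def genericPoint (u : Fin n → ℤ) : PrimeSpectrum (CoordRing (ray u)) :=
  ⟨RingHom.ker (toDivisor u).toRingHom, RingHom.ker_isPrime _⟩

lemma mem_genericPoint {u : Fin n → ℤ} {f : CoordRing (ray u)} :
    f ∈ (genericPoint u).asIdeal ↔
      ∀ m : dualMonoid (ray u), pairing m.1 (latticeVec u) = 0 → f.coeff m = 0 := by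
  classical
  change toDivisor u f = 0 ↔ _
  constructor
  · intro h m hm
    have := coeff_toDivisor u f m
    rw [h, if_pos hm] at this
    exact this.symm
  · intro h
    ext m
    by_cases hm : pairing m (latticeVec u) = 0
    · have := coeff_toDivisor u f ⟨m, mem_dualMonoid_ray.2 hm.ge⟩
      rw [if_pos hm, h _ hm] at this
      exact this
    · exact coeff_toDivisor_of_notMem u f hm

lemma chi_mem_genericPoint {u : Fin n → ℤ} {m : dualMonoid (ray u)} :
    chi m ∈ (genericPoint u).asIdeal ↔ pairing m.1 (latticeVec u) ≠ 0 := by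
  classical
  rw [mem_genericPoint]
  constructor
  · intro h h0
    have := h m h0
    simp at this
  · intro h a ha
    have : a ≠ m := by rintro rfl; exact h ha
    rw [AddMonoidAlgebra.coeff_single, Finsupp.single_eq_of_ne this]

/-- The generic point of the divisor of `u` specializes to every point at which all characters
that are positive on `u` vanish. -/
lemma comap_genericPoint_le {τ : Cone n} {u : Fin n → ℤ} (h : ray u ≤ τ)
    {P : PrimeSpectrum (CoordRing τ)}
    (hP : ∀ m : dualMonoid τ, 0 < pairing m.1 (latticeVec u) → chi m ∈ P.asIdeal) :
    PrimeSpectrum.comap (restrict h).toRingHom (genericPoint u) ≤ P := by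
  intro f hf
  have hf' := mem_genericPoint.1 (show restrict h f ∈ (genericPoint u).asIdeal from hf)
  rw [← AddMonoidAlgebra.sum_coeff_single f]
  refine P.asIdeal.sum_mem fun m hm => ?_
  rw [single_eq_smul_chi]
  refine Submodule.smul_of_tower_mem _ _ (hP m (lt_of_le_of_ne ?_ fun h0 => ?_))
  · exact mem_dualMonoid_ray.1 (dualMonoid_anti h m.2)
  · have := hf' ⟨m.1, dualMonoid_anti h m.2⟩ h0.symm
    rw [coeff_restrict] at this
    exact (Finsupp.mem_support_iff.1 hm) this

end GenericPoint

/-! ### Toric divisors and the complement of an affine chart -/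

section Divisors

variable {n : ℕ} (F : Fan n)

/-- The nonzero lattice vectors that span a ray of the fan. -/
abbrev Fan.RayVec : Type := {u : Fin n → ℤ // u ≠ 0 ∧ ray u ∈ F.cones}

/-- The prime divisor of `X_Σ` that belongs to a ray of the fan: the closure of the generic point
of the divisor in the chart of the ray. -/
def Fan.divisor (u : F.RayVec) : Set F.Space := closure {F.chart u.2.2 (genericPoint u.1)}

variable {F} {σ τ : Cone n} (hσ : σ ∈ F.cones) (hτ : τ ∈ F.cones)

lemma Fan.chart_comap (h : τ ≤ σ) (P : PrimeSpectrum (CoordRing τ)) :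
    F.chart hσ (PrimeSpectrum.comap (restrict h).toRingHom P) = F.chart hτ P := by
  have H := isGluingSystem_spec F
  refine (F.chart_eq_iff hσ hτ).2 ⟨PrimeSpectrum.comap (restrict (le_inf h le_rfl)).toRingHom P,
    H.comp _ _ P, ?_⟩
  exact (H.comp _ _ P).trans (H.self P)

lemma Fan.chart_mem_divisor {u : F.RayVec} (hu : latticeVec u.1 ∈ τ)
    {P : PrimeSpectrum (CoordRing τ)} (hP : IsOrth P u.1) : F.chart hτ P ∈ F.divisor u := by
  have hle := comap_genericPoint_le (ray_le.2 hu) (P := P) fun m hm => by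
    by_contra h
    exact hm.ne' (hP m h)
  have := ((PrimeSpectrum.le_iff_specializes _ _).1 hle).map (F.continuous_chart hτ)
  rw [F.chart_comap hτ u.2.2] at this
  exact specializes_iff_mem_closure.1 this

/-- The generic point of the divisor of a ray lies only in the charts of cones containing it. -/
lemma Fan.mem_of_genericPoint_mem {u : F.RayVec}
    (h : F.chart u.2.2 (genericPoint u.1) ∈ Set.range (F.chart hσ)) : latticeVec u.1 ∈ σ := by
  obtain ⟨Q, hQ⟩ := h
  obtain ⟨z, hz, -⟩ := (F.chart_eq_iff u.2.2 hσ).1 hQ.symm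
  obtain ⟨m, hm⟩ := (F.inter_face _ u.2.2 σ hσ).1.exists_cutsOut
  have h1 := (hm.mem_range_comap (F.rational _ u.2.2)).1 ⟨z, hz⟩
  rw [chi_mem_genericPoint, not_not] at h1
  exact ((hm _).2 ⟨latticeVec_mem_ray _, h1⟩).2

lemma Fan.isOpen_range_chart : IsOpen (Set.range (F.chart hσ)) :=
  (F.isOpenMap_chart hσ).isOpen_range

lemma Fan.divisor_subset_compl {u : F.RayVec} (hu : latticeVec u.1 ∉ σ) :
    F.divisor u ⊆ (Set.range (F.chart hσ))ᶜ := by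
  refine closure_minimal ?_ (F.isOpen_range_chart hσ).isClosed_compl
  rintro _ rfl h
  exact hu (F.mem_of_genericPoint_mem hσ h)

lemma Fan.divisor_eq_of_subset {u v : F.RayVec} (h : F.divisor u ⊆ F.divisor v) :
    F.divisor u = F.divisor v := by
  have h1 : F.chart u.2.2 (genericPoint u.1) ∈ F.divisor v := h (subset_closure rfl)
  -- the chart of the ray of `u` is an open neighbourhood of the generic point of its divisor
  obtain ⟨_, h2, rfl⟩ := mem_closure_iff.1 h1 _ (F.isOpen_range_chart u.2.2) ⟨_, rfl⟩
  have h3 := F.mem_of_genericPoint_mem u.2.2 h2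
  have h4 : ray v.1 = ray u.1 := ray_eq_of_mem v.2.1 h3
  refine h.antisymm (closure_minimal ?_ isClosed_closure)
  rintro _ rfl
  refine F.chart_mem_divisor v.2.2 (h4 ▸ latticeVec_mem_ray u.1) fun b hb => ?_
  have hb' : pairing b.1 (latticeVec v.1) = 0 := by
    by_contra h0
    exact hb (chi_mem_genericPoint.2 h0)
  obtain ⟨c, -, hc⟩ := mem_ray.1 (show latticeVec u.1 ∈ ray v.1 from h4 ▸ latticeVec_mem_ray u.1)
  rw [hc, pairing_smul_right, hb', mul_zero]

/-- A point of `U_τ` that does not lie in `U_σ` lies in the divisor of a ray of `τ` not in `σ`. -/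
lemma Fan.exists_orth_notMem {G : Finset (Fin n → ℤ)} (hG : τ = coneOf G)
    {P : PrimeSpectrum (CoordRing τ)} (hP : F.chart hτ P ∉ Set.range (F.chart hσ)) :
    ∃ g ∈ G, latticeVec g ∉ σ ∧ IsOrth P g := by
  by_contra! hcon
  obtain ⟨m, hm⟩ := (F.inter_face τ hτ σ hσ).1.exists_cutsOut
  have h1 : m ∈ unitFace P := by
    refine mem_unitFace_of_orth hG P m fun g hg h => ?_
    have hgσ : latticeVec g ∈ σ := by
      by_contra h'
      exact hcon g hg h' h
    exact ((hm _).1 ⟨hG ▸ latticeVec_mem_coneOf hg, hgσ⟩).2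
  obtain ⟨z, rfl⟩ := (hm.mem_range_comap (F.rational τ hτ)).2 h1
  exact hP ⟨PrimeSpectrum.comap (restrict inf_le_right).toRingHom z,
    ((F.chart_eq_iff hτ hσ).2 ⟨z, rfl, rfl⟩).symm⟩

variable (F) in
/-- Finitely many lattice vectors spanning rays of the fan generate all its cones. -/
lemma Fan.exists_generators : ∃ R : Finset F.RayVec, ∀ τ ∈ F.cones,
    ∃ G : Finset (Fin n → ℤ), τ = coneOf G ∧ ∀ g ∈ G, ∃ u ∈ R, u.1 = g := by
  classical
  have h : ∀ τ : {τ // τ ∈ F.cones}, ∃ G : Finset F.RayVec, τ.1 = coneOf (G.image Subtype.val) := by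
    rintro ⟨τ, hτ⟩
    obtain ⟨G, hG, hface⟩ := exists_face_generators (F.rational τ hτ) (F.stronglyConvex τ hτ)
    let e : {g // g ∈ G} → F.RayVec := fun g =>
      ⟨g.1, (hface g.1 g.2).1, F.face_mem τ hτ _ (hface g.1 g.2).2⟩
    have he : (G.attach.image e).image Subtype.val = G := by
      ext g
      constructor
      · intro hg
        obtain ⟨v, hv, rfl⟩ := Finset.mem_image.1 hg
        obtain ⟨w, -, rfl⟩ := Finset.mem_image.1 hv
        exact w.2
      · intro hg
        exact Finset.mem_image.2
          ⟨e ⟨g, hg⟩, Finset.mem_image_of_mem e (Finset.mem_attach G ⟨g, hg⟩), rfl⟩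
    exact ⟨G.attach.image e, by rw [he]; exact hG⟩
  choose G hG using h
  refine ⟨Finset.univ.biUnion G, fun τ hτ => ⟨_, hG ⟨τ, hτ⟩, fun g hg => ?_⟩⟩
  obtain ⟨u, hu, rfl⟩ := Finset.mem_image.1 hg
  exact ⟨u, Finset.mem_biUnion.2 ⟨_, Finset.mem_univ _, hu⟩, rfl⟩

/-- The divisors of the rays of the fan that do not lie in `σ` are irreducible components of
`X_Σ ∖ U_σ`. -/
theorem Fan.divisor_isComponentOf {u : F.RayVec} (hu : latticeVec u.1 ∉ σ) :
    IsComponentOf (F.divisor u) (Set.range (F.chart hσ))ᶜ := by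
  classical
  refine ⟨⟨isIrreducible_singleton.closure, F.divisor_subset_compl hσ hu⟩, ?_⟩
  rintro A ⟨hA, hAσ⟩ hle
  obtain ⟨R, hR⟩ := F.exists_generators
  -- finitely many divisors cover the complement of `U_σ`
  obtain ⟨Z, hZ, hAZ⟩ := isIrreducible_iff_sUnion_isClosed.1 hA (R.image F.divisor) (by
      intro Z hZ
      obtain ⟨v, -, rfl⟩ := Finset.mem_image.1 hZ
      exact isClosed_closure) (by
      intro x hx
      obtain ⟨⟨⟨τ, hτ⟩, P⟩, rfl⟩ := Quot.exists_rep x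
      obtain ⟨G, hG, hGR⟩ := hR τ hτ
      obtain ⟨g, hg, -, horth⟩ := F.exists_orth_notMem hσ hτ hG (P := P) (hAσ hx)
      obtain ⟨v, hv, rfl⟩ := hGR g hg
      exact ⟨F.divisor v, Finset.mem_coe.2 (Finset.mem_image_of_mem _ hv),
        F.chart_mem_divisor hτ (hG ▸ latticeVec_mem_coneOf hg) horth⟩)
  obtain ⟨v, -, rfl⟩ := Finset.mem_image.1 hZ
  rw [F.divisor_eq_of_subset (hle.trans hAZ)]
  exact hAZ

end Divisors

/-! ### Density of the torus -/

section Torus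

variable {n : ℕ}

/-- The real points of the torus, as the homomorphisms `t : M → ℝˣ`; the value of the character
`χ^m` at `t` is `t m`. -/
abbrev Torus (n : ℕ) : Type := Multiplicative (Fin n → ℤ) →* ℝ

/-- The value `χ^m(t)`. -/
def Torus.val (t : Torus n) (m : Fin n → ℤ) : ℝ := t (Multiplicative.ofAdd m)

lemma Torus.val_zero (t : Torus n) : t.val 0 = 1 := map_one t

lemma Torus.val_add (t : Torus n) (a b : Fin n → ℤ) : t.val (a + b) = t.val a * t.val b :=
  map_mul t _ _

lemma Torus.val_ne_zero (t : Torus n) (m : Fin n → ℤ) : t.val m ≠ 0 := by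
  intro h
  have := t.val_add m (-m)
  rw [add_neg_cancel, t.val_zero, h, zero_mul] at this
  exact one_ne_zero this

/-- The inclusion `T(ℝ) ⊆ U_σ(ℝ)`. -/
def Torus.toPoint (σ : Cone n) (t : Torus n) : RealPoints σ :=
  pointOf (fun m => t.val m.1) t.val_zero fun a b => t.val_add a.1 b.1

lemma Torus.eval_toPoint {σ : Cone n} (t : Torus n) (m : dualMonoid σ) :
    eval (chi m) (t.toPoint σ) = t.val m.1 :=
  eval_pointOf _ _ _ m

lemma Torus.map_toPoint {σ τ : Cone n} (h : τ ≤ σ) (t : Torus n) :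
    (t.toPoint τ).map h = t.toPoint σ := by
  refine realPoints_ext fun m => ?_
  rw [eval_map, restrict_single, t.eval_toPoint, t.eval_toPoint]

lemma Torus.realChart_toPoint {F : Fan n} {σ τ : Cone n} (hσ : σ ∈ F.cones) (hτ : τ ∈ F.cones)
    (t : Torus n) : F.realChart hσ (t.toPoint σ) = F.realChart hτ (t.toPoint τ) :=
  (F.realChart_eq_iff hσ hτ).2 ⟨t.toPoint _, t.map_toPoint _, t.map_toPoint _⟩

/-- The logarithm of the absolute values of the characters at a point of the torus is a vector
of `N_ℝ`. -/
lemma Torus.exists_log (t : Torus n) :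
    ∃ u : Fin n → ℝ, ∀ m, pairing m u = -Real.log |t.val m| := by
  let L : (Fin n → ℤ) →+ ℝ :=
    { toFun := fun m => -Real.log |t.val m|
      map_zero' := by simp [t.val_zero]
      map_add' := fun a b => by
        rw [t.val_add, abs_mul, Real.log_mul (abs_ne_zero.2 (t.val_ne_zero a))
          (abs_ne_zero.2 (t.val_ne_zero b)), neg_add] }
  refine ⟨fun i => L (Pi.single i 1), fun m => ?_⟩
  change _ = L m
  have hm : m = ∑ i, m i • (Pi.single i 1 : Fin n → ℤ) := by
    ext k; simp [Finset.sum_apply, Pi.single_apply]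
  conv_rhs => rw [hm, map_sum]
  exact Finset.sum_congr rfl fun i _ => by rw [map_zsmul, zsmul_eq_mul]

/-- Completeness of the fan on the level of the torus: at every point of the torus, all the
characters regular on one of the charts have absolute value at most `1`. -/
lemma Fan.IsComplete.exists_abs_le_one {F : Fan n} (hF : F.IsComplete) (t : Torus n) :
    ∃ τ ∈ F.cones, ∀ m ∈ dualMonoid τ, |t.val m| ≤ 1 := by
  obtain ⟨u, hu⟩ := t.exists_log
  obtain ⟨τ, hτ, huτ⟩ := hF u
  refine ⟨τ, hτ, fun m hm => ?_⟩
  have := hm u huτ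
  rw [hu] at this
  exact (Real.log_nonpos_iff (abs_nonneg _)).1 (by linarith)

/-- A homomorphism on the face of `H_σ` of a real point extends to the character lattice, as
the face generates a saturated subgroup, which is a direct summand. -/
lemma exists_torus_extension {σ : Cone n} (hσ : IsRational σ) (x : RealPoints σ) :
    ∃ t : Torus n, ∀ m ∈ unitFace x.toSpec, t.val m.1 = eval (chi m) x := by
  classical
  obtain ⟨G, hG⟩ := isRational_iff.1 hσ
  let G' := G.filter fun g => IsOrth x.toSpec g
  -- the lattice vectors orthogonal to the face, as functionals on `M`
  let L : (Fin n → ℤ) →ₗ[ℤ] (G' → ℤ) := LinearMap.pi fun g =>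
    ∑ i, (g : Fin n → ℤ) i • LinearMap.proj i
  have hL : ∀ m, L m = 0 ↔ ∀ g ∈ G, IsOrth x.toSpec g → pairing m (latticeVec g) = 0 := by
    intro m
    have hval : ∀ g : G', (L m g : ℝ) = pairing m (latticeVec g) := by
      intro g
      rw [pairing_latticeVec]
      simp [L, mul_comm]
    constructor
    · intro h g hg horth
      rw [← hval ⟨g, Finset.mem_filter.2 ⟨hg, horth⟩⟩, h]; simp
    · intro h
      ext g
      have := Finset.mem_filter.1 g.2
      have h1 := h g.1 this.1 this.2
      rw [← hval] at h1
      exact_mod_cast h1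
  obtain ⟨s, hs⟩ := Module.projective_lifting_property L.rangeRestrict LinearMap.id
    L.surjective_rangeRestrict
  let r : (Fin n → ℤ) →ₗ[ℤ] (Fin n → ℤ) := LinearMap.id - s ∘ₗ L.rangeRestrict
  have hr : ∀ m, L (r m) = 0 := by
    intro m
    have h1 : L.rangeRestrict (s (L.rangeRestrict m)) = L.rangeRestrict m :=
      LinearMap.congr_fun hs _
    have h2 : L (s (L.rangeRestrict m)) = L m := congrArg Subtype.val h1
    simp only [r, LinearMap.sub_apply, LinearMap.id_apply, LinearMap.comp_apply, map_sub, h2,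
      sub_self]
  have hr' : ∀ m, L m = 0 → r m = m := by
    intro m hm
    have h1 : L.rangeRestrict m = 0 := Subtype.ext hm
    simp only [r, LinearMap.sub_apply, LinearMap.id_apply, LinearMap.comp_apply, h1, map_zero,
      sub_zero]
  -- the elements of `ker L` are differences of elements of the face
  have hdiff : ∀ m, ∃ c ∈ unitFace x.toSpec, r m + c.1 ∈ dualMonoid σ := by
    intro m
    exact exists_add_mem hG x.toSpec fun g hg h => ((hL _).1 (hr m) g hg h).ge
  choose c hc hmem using hdiff
  have hc0 : ∀ m, eval (chi (c m)) x ≠ 0 := hc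
  have hmul : ∀ a b : dualMonoid σ, eval (chi (a + b)) x = eval (chi a) x * eval (chi b) x :=
    fun a b => by rw [chi_add, eval_mul]
  let X : (Fin n → ℤ) → ℝ := fun m => eval (chi ⟨_, hmem m⟩) x / eval (chi (c m)) x
  refine ⟨{ toFun := fun m => X m.toAdd, map_one' := ?_, map_mul' := fun a b => ?_ }, ?_⟩
  · change X 0 = 1
    have : (⟨_, hmem 0⟩ : dualMonoid σ) = c 0 := Subtype.ext (by simp)
    simp only [X]
    rw [this, div_self (hc0 0)]
  · change X (a.toAdd + b.toAdd) = X a.toAdd * X b.toAdd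
    set a' := a.toAdd
    set b' := b.toAdd
    simp only [X]
    rw [div_mul_div_comm, div_eq_div_iff (hc0 _) (mul_ne_zero (hc0 _) (hc0 _)), ← hmul, ← hmul,
      ← hmul, ← hmul]
    congr 2
    refine Subtype.ext ?_
    change r (a' + b') + (c (a' + b')).1 + ((c a').1 + (c b').1)
      = r a' + (c a').1 + (r b' + (c b').1) + (c (a' + b')).1
    rw [map_add]
    abel
  · intro m hm
    change X m.1 = _
    have hLm : L m.1 = 0 := (hL _).2 fun g _ h => h m hm
    have : (⟨_, hmem m.1⟩ : dualMonoid σ) = m + c m.1 := Subtype.ext (by simp [hr' _ hLm])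
    simp only [X]
    rw [this, hmul, mul_div_assoc, div_self (hc0 _), mul_one]

/-- The real points of the torus are dense in `U_σ(ℝ)`: every real point is a limit along a
one-parameter subgroup of a translate of the torus. -/
theorem dense_torus {σ : Cone n} (hσ : IsRational σ) :
    Dense (Set.range (Torus.toPoint σ)) := by
  classical
  intro x
  obtain ⟨t, ht⟩ := exists_torus_extension hσ x
  obtain ⟨G, hG⟩ := isRational_iff.1 hσ
  -- a lattice vector in the relative interior of the face of `σ` dual to that of `x`
  let v : Fin n → ℝ := ∑ g ∈ G.filter (fun g => IsOrth x.toSpec g), latticeVec g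
  have hge : ∀ (m : dualMonoid σ), ∀ g ∈ G, 0 ≤ pairing m.1 (latticeVec g) := fun m g hg =>
    m.2 _ (hG ▸ latticeVec_mem_coneOf hg)
  have hv0 : ∀ m ∈ unitFace x.toSpec, pairing m.1 v = 0 := by
    intro m hm
    rw [pairing_sum_right]
    exact Finset.sum_eq_zero fun g hg => (Finset.mem_filter.1 hg).2 m hm
  have hvpos : ∀ m : dualMonoid σ, m ∉ unitFace x.toSpec → 0 < pairing m.1 v := by
    intro m hm
    rw [pairing_sum_right]
    refine lt_of_le_of_ne (Finset.sum_nonneg fun g hg => hge m g (Finset.mem_filter.1 hg).1) ?_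
    intro h0
    refine hm (mem_unitFace_of_orth hG _ m fun g hg horth => ?_)
    exact (Finset.sum_eq_zero_iff_of_nonneg fun g hg => hge m g (Finset.mem_filter.1 hg).1).1
      h0.symm g (Finset.mem_filter.2 ⟨hg, horth⟩)
  let γ : ℕ → Torus n := fun k =>
    { toFun := fun m => t.val m.toAdd * Real.exp (-(k * pairing m.toAdd v))
      map_one' := by
        change t.val 0 * Real.exp (-(k * pairing 0 v)) = 1
        rw [t.val_zero, pairing_zero_left]; simp
      map_mul' := fun a b => by
        change t.val (a.toAdd + b.toAdd) * Real.exp (-(k * pairing (a.toAdd + b.toAdd) v)) = _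
        rw [t.val_add, pairing_add_left, mul_add, neg_add, Real.exp_add]; ring }
  have hγ : ∀ k m, (γ k).val m = t.val m * Real.exp (-(k * pairing m v)) := fun _ _ => rfl
  refine mem_closure_of_tendsto (f := fun k => (γ k).toPoint σ) (b := Filter.atTop)
    (tendsto_realPoints fun m => ?_) (Filter.Eventually.of_forall fun k => ⟨_, rfl⟩)
  simp only [Torus.eval_toPoint, hγ]
  by_cases hm : m ∈ unitFace x.toSpec
  · simp only [hv0 m hm, mul_zero, neg_zero, Real.exp_zero, mul_one, ht m hm]
    exact tendsto_const_nhds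
  · have h0 : eval (chi m) x = 0 := by
      by_contra h; exact hm h
    rw [h0, ← mul_zero (t.val m.1)]
    refine Filter.Tendsto.const_mul _ (Real.tendsto_exp_neg_atTop_nhds_zero.comp ?_)
    exact tendsto_natCast_atTop_atTop.atTop_mul_const (hvpos m hm)

end Torus

/-! ### Limits in complete toric varieties -/

section Boundedness

variable {n : ℕ} {F : Fan n} {σ : Cone n} (hσ : σ ∈ F.cones)

/-- Along an ultrafilter, points of the torus converge to a real point of one of the
charts of a complete fan. -/
lemma Fan.IsComplete.exists_limit (hF : F.IsComplete) (l : Ultrafilter ℕ) (t : ℕ → Torus n) :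
    ∃ (τ : Cone n) (_ : τ ∈ F.cones) (p : RealPoints τ),
      Filter.Tendsto (fun k => (t k).toPoint τ) l (nhds p) := by
  choose τ hτ hle using fun k => hF.exists_abs_le_one (t k)
  -- one of the finitely many cones occurs along the ultrafilter
  obtain ⟨τ₀, hτ₀, hev⟩ : ∃ τ₀ ∈ (F.cones : Set (Cone n)), τ ⁻¹' {τ₀} ∈ l := by
    rw [← Ultrafilter.finite_biUnion_mem_iff (Finset.finite_toSet F.cones)]
    exact Filter.mem_of_superset Filter.univ_mem fun k _ =>
      Set.mem_biUnion (Finset.mem_coe.2 (hτ k)) rfl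
  have hlim : ∀ m : dualMonoid τ₀, ∃ a, Filter.Tendsto (fun k => (t k).val m.1) l (nhds a) := by
    intro m
    obtain ⟨a, -, ha⟩ := (isCompact_Icc (a := (-1 : ℝ)) (b := 1)).ultrafilter_le_nhds
      (l.map fun k => (t k).val m.1) (by
        rw [Filter.le_principal_iff, Ultrafilter.mem_coe, Ultrafilter.mem_map]
        refine Filter.mem_of_superset hev fun k hk => ?_
        have hk' : τ k = τ₀ := hk
        exact abs_le.1 (hle k m.1 (hk' ▸ m.2)))
    exact ⟨a, ha⟩
  choose φ hφ using hlim
  have h0 : φ 0 = 1 := by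
    refine tendsto_nhds_unique (hφ 0) ?_
    simp only [ZeroMemClass.coe_zero, Torus.val_zero]
    exact tendsto_const_nhds
  have hadd : ∀ a b, φ (a + b) = φ a * φ b := by
    intro a b
    refine tendsto_nhds_unique (hφ (a + b)) ?_
    simp only [AddSubmonoid.coe_add, Torus.val_add]
    exact (hφ a).mul (hφ b)
  refine ⟨τ₀, hτ₀, pointOf φ h0 hadd, tendsto_realPoints fun m => ?_⟩
  simp only [Torus.eval_toPoint, eval_pointOf]
  exact hφ m

/-- A character without poles along the divisors that meet the closure of `S` is bounded on
`S`. -/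
theorem Fan.IsComplete.chi_bounded (hF : F.IsComplete) {R : Finset F.RayVec}
    (hR : ∀ τ ∈ F.cones, ∃ G : Finset (Fin n → ℤ), τ = coneOf G ∧ ∀ g ∈ G, ∃ u ∈ R, u.1 = g)
    {S : Set (RealPoints σ)} (hS : S ⊆ closure (S ∩ Set.range (Torus.toPoint σ)))
    (m : dualMonoid σ)
    (hm : ∀ u ∈ R, (F.toSpace ⁻¹' F.divisor u ∩ closure (F.realChart hσ '' S)).Nonempty →
      0 ≤ pairing m.1 (latticeVec u.1)) :
    ∃ c : ℝ, ∀ x ∈ S, |eval (chi m) x| ≤ c := by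
  suffices h : ∃ c : ℝ, ∀ x ∈ S ∩ Set.range (Torus.toPoint σ), |eval (chi m) x| ≤ c by
    obtain ⟨c, hc⟩ := h
    refine ⟨c, fun x hx => ?_⟩
    have hcl : IsClosed {x : RealPoints σ | |eval (chi m) x| ≤ c} :=
      isClosed_le (continuous_eval (chi m)).abs continuous_const
    exact closure_minimal (fun x hx => hc x hx) hcl (hS hx)
  by_contra! hcon
  have hseq : ∀ k : ℕ, ∃ t : Torus n, t.toPoint σ ∈ S ∧ (k : ℝ) < |t.val m.1| := by
    intro k
    obtain ⟨_, ⟨hx, t, rfl⟩, hk⟩ := hcon k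
    exact ⟨t, hx, by rwa [t.eval_toPoint] at hk⟩
  choose t htS ht using hseq
  obtain ⟨τ, hτ, p, hp⟩ := hF.exists_limit (Filter.hyperfilter ℕ) t
  have hpcl : F.realChart hτ p ∈ closure (F.realChart hσ '' S) := by
    refine mem_closure_of_tendsto (((F.continuous_realChart hτ).tendsto p).comp hp)
      (Filter.Eventually.of_forall fun k => ⟨_, htS k, ?_⟩)
    exact (t k).realChart_toPoint hσ hτ
  obtain ⟨G, hG, hGR⟩ := hR τ hτ
  -- `χ^m` is regular at the limit point
  obtain ⟨c, hc, hmem⟩ := exists_add_mem hG p.toSpec (m := m.1) fun g hg horth => by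
    obtain ⟨u, hu, rfl⟩ := hGR g hg
    exact hm u hu ⟨_, F.chart_mem_divisor hτ (hG ▸ latticeVec_mem_coneOf hg) horth, hpcl⟩
  have hev : ∀ a : dualMonoid τ, Filter.Tendsto (fun k => (t k).val a.1)
      (Filter.hyperfilter ℕ : Filter ℕ) (nhds (eval (chi a) p)) := by
    intro a
    have := ((continuous_eval (chi a)).tendsto p).comp hp
    simpa only [Function.comp_def, Torus.eval_toPoint] using this
  have hlim : Filter.Tendsto (fun k => |(t k).val m.1|) (Filter.hyperfilter ℕ : Filter ℕ)
      (nhds |eval (chi ⟨_, hmem⟩) p / eval (chi c) p|) := by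
    have := ((hev ⟨_, hmem⟩).div (hev c) hc).abs
    refine this.congr fun k => ?_
    change |(t k).val (m.1 + c.1) / (t k).val c.1| = _
    rw [(t k).val_add, mul_div_assoc, div_self ((t k).val_ne_zero _), mul_one]
  have hinf : Filter.Tendsto (fun k => |(t k).val m.1|) (Filter.hyperfilter ℕ : Filter ℕ)
      Filter.atTop := by
    refine Filter.tendsto_atTop_mono (fun k => (ht k).le) ?_
    exact tendsto_natCast_atTop_atTop.mono_left Nat.hyperfilter_le_atTop
  exact not_tendsto_nhds_of_tendsto_atTop hinf _ hlim

end Boundedness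

/-! ### Pole orders of sums of nonnegative functions -/

section PoleOrders

variable {n : ℕ} {F : Fan n} {σ : Cone n} (hσ : σ ∈ F.cones)

lemma Fan.chart_injective : Function.Injective (F.chart hσ) := by
  intro p q h
  obtain ⟨z, h₁, h₂⟩ := (F.chart_eq_iff hσ hσ).1 h
  exact h₁.symm.trans h₂

/-- Within the chart of the ray, the divisor consists of the specializations of its generic
point. -/
lemma Fan.genericPoint_le_of_mem_divisor {u : F.RayVec} {P : PrimeSpectrum (CoordRing (ray u.1))}
    (h : F.chart u.2.2 P ∈ F.divisor u) : genericPoint u.1 ≤ P := by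
  have hemb := Topology.IsOpenEmbedding.of_continuous_injective_isOpenMap
    (F.continuous_chart u.2.2) (F.chart_injective u.2.2) (F.isOpenMap_chart u.2.2)
  rw [PrimeSpectrum.le_iff_specializes, ← hemb.isInducing.specializes_iff]
  exact specializes_iff_mem_closure.2 h

/-- The chart of a ray meets the chart of a cone not containing it in the torus only. -/
lemma mem_dualMonoid_inf {u : Fin n → ℤ} (hu : latticeVec u ∉ σ) (m : Fin n → ℤ) :
    m ∈ dualMonoid (ray u ⊓ σ) := by
  rintro w ⟨hw, hwσ⟩
  obtain ⟨c, hc, rfl⟩ := mem_ray.1 hw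
  rcases hc.eq_or_lt with rfl | hc
  · rw [zero_smul, pairing_zero_right]
  · refine absurd ?_ hu
    have := smul_mem_cone (inv_pos.2 hc).le hwσ
    rwa [smul_smul, inv_mul_cancel₀ hc.ne', one_smul] at this

lemma coeff_mul_chi_neg {κ : Cone n} (f : CoordRing κ) {a b c : dualMonoid κ}
    (h : c.1 + a.1 = b.1) (ha : -a.1 ∈ dualMonoid κ) :
    (f * chi ⟨-a.1, ha⟩).coeff c = f.coeff b := by
  rw [AddMonoidAlgebra.coeff_mul_single_eq_coeff_mul b fun m _ => ?_, mul_one]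
  rw [Subtype.ext_iff, Subtype.ext_iff, ← h]
  change m.1 + -a.1 = c.1 ↔ _
  rw [← sub_eq_add_neg, sub_eq_iff_eq_add]

/-- A function `f` on `U_σ` whose characters `χ^m` satisfy `⟨m, u⟩ ≥ ⟨m₀, u⟩` can be divided by
`χ^{m₀}` in the ring of functions on the chart of the ray spanned by `u`. -/
lemma exists_div_chi {u : Fin n → ℤ} (hu : latticeVec u ∉ σ) (m₀ : Fin n → ℤ)
    (f : CoordRing σ)
    (hf : ∀ m, f.coeff m ≠ 0 → pairing m₀ (latticeVec u) ≤ pairing m.1 (latticeVec u)) :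
    ∃ g : CoordRing (ray u), restrict inf_le_left g =
        restrict (inf_le_right : ray u ⊓ σ ≤ σ) f * chi ⟨-m₀, mem_dualMonoid_inf hu _⟩ ∧
      (∀ (m : dualMonoid σ) (a : dualMonoid (ray u)), a.1 + m₀ = m.1 → g.coeff a = f.coeff m) ∧
      ∀ a : dualMonoid (ray u), g.coeff a ≠ 0 → a.1 + m₀ ∈ dualMonoid σ := by
  set f' := restrict (inf_le_right : ray u ⊓ σ ≤ σ) f
  have hco : ∀ c : dualMonoid (ray u ⊓ σ), (f' * chi ⟨-m₀, mem_dualMonoid_inf hu _⟩).coeff c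
      = f'.coeff ⟨c.1 + m₀, mem_dualMonoid_inf hu _⟩ := fun c =>
    coeff_mul_chi_neg f' (a := ⟨m₀, mem_dualMonoid_inf hu _⟩) rfl _
  obtain ⟨g, hg⟩ := exists_restrict_eq (inf_le_left : ray u ⊓ σ ≤ ray u)
      (f := f' * chi ⟨-m₀, mem_dualMonoid_inf hu _⟩) (by
    intro c hc
    rw [hco] at hc
    obtain ⟨m, hm, hne⟩ := exists_coeff_of_coeff_restrict_ne_zero _ hc
    have h1 := hf m hne
    rw [hm, pairing_add_left] at h1
    exact mem_dualMonoid_ray.2 (by linarith))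
  have hga : ∀ a : dualMonoid (ray u),
      g.coeff a = f'.coeff ⟨a.1 + m₀, mem_dualMonoid_inf hu _⟩ := fun a => by
    rw [← coeff_restrict (inf_le_left : ray u ⊓ σ ≤ ray u) g a, hg, hco]
  refine ⟨g, hg, fun m a ham => ?_, fun a ha => ?_⟩
  · rw [hga, ← coeff_restrict (inf_le_right : ray u ⊓ σ ≤ σ) f m]
    congr 1
    exact Subtype.ext ham
  · rw [hga] at ha
    obtain ⟨m, hm, -⟩ := exists_coeff_of_coeff_restrict_ne_zero _ ha
    have h := m.2
    rwa [hm] at h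

/-- No cancellation of poles: if the closure of `S` is Zariski-dense in the divisor of a ray
outside `σ`, then a sum of functions that are nonnegative on `S` has along this divisor a pole
of the largest order of the poles of the summands. -/
theorem Fan.le_pairing_of_sum {u : F.RayVec} (hu : latticeVec u.1 ∉ σ)
    {S : Set (RealPoints σ)}
    (hdense : F.divisor u ⊆
      closure (F.toSpace '' (F.toSpace ⁻¹' F.divisor u ∩ closure (F.realChart hσ '' S))))
    {ι : Type*} [Fintype ι] (f : ι → CoordRing σ) (hf : ∀ i, f i ∈ nonnegFunctions S) (d : ℝ)
    (hsum : ∀ m, (∑ i, f i).coeff m ≠ 0 → d ≤ pairing m.1 (latticeVec u.1)) (i : ι)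
    (m : dualMonoid σ) (hm : (f i).coeff m ≠ 0) : d ≤ pairing m.1 (latticeVec u.1) := by
  classical
  by_contra! hlt
  -- a character `m₀` of the largest pole order among all those in the `f i`
  obtain ⟨m₀, hm₀, hmin⟩ := Finset.exists_min_image
    (Finset.univ.biUnion fun i => (f i).coeff.support)
    (fun m => pairing m.1 (latticeVec u.1))
    ⟨m, Finset.mem_biUnion.2 ⟨i, Finset.mem_univ i, Finsupp.mem_support_iff.2 hm⟩⟩
  have hmin' : ∀ j m, (f j).coeff m ≠ 0 →
      pairing m₀.1 (latticeVec u.1) ≤ pairing m.1 (latticeVec u.1) := fun j m h =>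
    hmin m (Finset.mem_biUnion.2 ⟨j, Finset.mem_univ j, Finsupp.mem_support_iff.2 h⟩)
  have hm₀d : pairing m₀.1 (latticeVec u.1) < d := (hmin' i m hm).trans_lt hlt
  obtain ⟨j, -, hj⟩ := Finset.mem_biUnion.1 hm₀
  rw [Finsupp.mem_support_iff] at hj
  choose g hg hgcoeff hgmem using fun j => exists_div_chi hu m₀.1 (f j) (hmin' j)
  -- the quotient of `f j` by `χ^{m₀}` does not vanish identically on the divisor
  have hgj : g j ∉ (genericPoint u.1).asIdeal := by
    intro h
    have h1 := mem_genericPoint.1 h 0 (pairing_zero_left _)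
    rw [hgcoeff j m₀ 0 (by simp)] at h1
    exact hj h1
  -- but the sum of the quotients does
  have hgsum : ∑ j, g j ∈ (genericPoint u.1).asIdeal := by
    refine mem_genericPoint.2 fun a ha => ?_
    have hd : pairing (a.1 + m₀.1) (latticeVec u.1) < d := by
      rw [pairing_add_left, ha, zero_add]; exact hm₀d
    rw [AddMonoidAlgebra.coeff_sum, Finsupp.finsetSum_apply]
    by_cases hmem : a.1 + m₀.1 ∈ dualMonoid σ
    · by_contra hne
      refine not_le.2 hd (hsum ⟨_, hmem⟩ ?_)
      rw [AddMonoidAlgebra.coeff_sum, Finsupp.finsetSum_apply]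
      rwa [Finset.sum_congr rfl fun j _ => (hgcoeff j ⟨_, hmem⟩ a rfl)] at hne
    · exact Finset.sum_eq_zero fun j _ => not_not.1 fun h => hmem (hgmem j a h)
  -- a real point of the divisor in the closure of `S` at which `g j` does not vanish
  obtain ⟨_, ⟨Q, hQ, rfl⟩, p, ⟨hpZ, hpS⟩, hpQ⟩ := mem_closure_iff.1
    (hdense (subset_closure rfl)) _
    (F.isOpenMap_chart u.2.2 _ (PrimeSpectrum.isOpen_basicOpen (a := g j)))
    ⟨genericPoint u.1, hgj, rfl⟩
  obtain ⟨x, rfl⟩ := F.exists_realChart_of_toSpace u.2.2 hpQ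
  have hxQ : x.toSpec = Q := F.chart_injective u.2.2 hpQ
  have hgjx : eval (g j) x ≠ 0 := by
    rw [← hxQ] at hQ
    exact hQ
  have hzero : ∑ j, eval (g j) x = 0 := by
    rw [← eval_sum]
    exact F.genericPoint_le_of_mem_divisor (P := x.toSpec) hpZ hgsum
  -- near `x`, all `f i` are nonnegative on `S`, so that the signs of the `g i` agree
  have hsign : ∀ i k, 0 < eval (g i) x → ¬ eval (g k) x < 0 := by
    intro i k hi hk
    have hopen : IsOpen {y : RealPoints (ray u.1) | 0 < eval (g i) y ∧ eval (g k) y < 0} :=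
      (isOpen_lt continuous_const (continuous_eval _)).inter
        (isOpen_lt (continuous_eval _) continuous_const)
    obtain ⟨_, ⟨y, ⟨hy1, hy2⟩, rfl⟩, s, hs, hsy⟩ := mem_closure_iff.1 hpS _
      (F.isOpenMap_realChart u.2.2 _ hopen) ⟨x, ⟨hi, hk⟩, rfl⟩
    obtain ⟨z, rfl, rfl⟩ : ∃ z : RealPoints (ray u.1 ⊓ σ),
        z.map inf_le_left = y ∧ z.map inf_le_right = s :=
      (F.realChart_eq_iff u.2.2 hσ).1 hsy.symm
    have hval : ∀ i, eval (g i) (z.map inf_le_left) = eval (f i) (z.map inf_le_right) *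
        eval (chi ⟨-m₀.1, mem_dualMonoid_inf hu _⟩) z := by
      intro i
      rw [eval_map, hg, eval_mul, eval_map]
    have h1 := hf i _ hs
    have h2 := hf k _ hs
    rw [hval] at hy1 hy2
    have h3 : 0 < eval (chi ⟨-m₀.1, mem_dualMonoid_inf hu _⟩) z :=
      lt_of_not_ge fun h => hy1.not_ge (mul_nonpos_of_nonneg_of_nonpos h1 h)
    exact absurd hy2 (not_lt.2 (mul_nonneg h2 h3.le))
  rcases lt_or_gt_of_ne hgjx with h | h
  · have : ∑ j, eval (g j) x < 0 := Finset.sum_neg' (fun i _ => not_lt.1 fun hi => hsign i j hi h)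
      ⟨j, Finset.mem_univ j, h⟩
    exact this.ne hzero
  · have : 0 < ∑ j, eval (g j) x := Finset.sum_pos' (fun i _ => not_lt.1 fun hi => hsign j i h hi)
      ⟨j, Finset.mem_univ j, h⟩
    exact this.ne' hzero

end PoleOrders

/-! ### Total stability -/

section FiniteSupport

variable {n : ℕ} {σ : Cone n}

lemma mem_span_chi (s : Set (dualMonoid σ)) (f : CoordRing σ) (hf : ∀ m, f.coeff m ≠ 0 → m ∈ s) :
    f ∈ Submodule.span ℝ (chi '' s) := by
  rw [← AddMonoidAlgebra.sum_coeff_single f]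
  refine Submodule.sum_mem _ fun m hm => ?_
  rw [single_eq_smul_chi]
  exact Submodule.smul_mem _ _ (Submodule.subset_span ⟨m, hf m (Finsupp.mem_support_iff.1 hm), rfl⟩)

/-- The functions in a finite-dimensional space involve only finitely many characters. -/
lemma exists_common_support (U : Submodule ℝ (CoordRing σ)) [FiniteDimensional ℝ U] :
    ∃ B : Finset (dualMonoid σ), ∀ f ∈ U, ∀ m, f.coeff m ≠ 0 → m ∈ B := by
  classical
  obtain ⟨s, hs⟩ := (Module.Finite.iff_fg (N := U)).1 inferInstance
  refine ⟨s.biUnion fun f => f.coeff.support, fun f hf => ?_⟩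
  rw [← hs] at hf
  induction hf using Submodule.span_induction with
  | mem f hf =>
    exact fun m hm => Finset.mem_biUnion.2 ⟨f, hf, Finsupp.mem_support_iff.2 hm⟩
  | zero => exact fun m hm => absurd (by simp) hm
  | add f g _ _ hf hg =>
    intro m hm
    by_cases h : f.coeff m = 0
    · refine hg m fun h' => hm ?_
      rw [AddMonoidAlgebra.coeff_add, Finsupp.add_apply, h, h', add_zero]
    · exact hf m h
  | smul c f _ hf =>
    refine fun m hm => hf m fun h => hm ?_
    rw [AddMonoidAlgebra.coeff_smul, Finsupp.smul_apply, h, smul_zero]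

lemma eq_zero_of_chi_bounded {S : Set (RealPoints σ)} (hB : boundedFunctions S = ⊥)
    {m : dualMonoid σ} (h : ∃ c : ℝ, ∀ x ∈ S, |eval (chi m) x| ≤ c) : m = 0 := by
  classical
  have hmem : chi m ∈ boundedFunctions S := h
  rw [hB] at hmem
  obtain ⟨r, hr⟩ := Algebra.mem_bot.1 hmem
  by_contra h0
  have := congrArg (fun f : CoordRing σ => f.coeff m) hr
  simp [AddMonoidAlgebra.coe_algebraMap, AddMonoidAlgebra.coeff_single, Ne.symm h0] at this

end FiniteSupport

end

end Toric

open Toric in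
theorem theorem5p4 (n : ℕ) (σ : Toric.Cone n) (hrat : Toric.IsRational σ)
    (hpt : Toric.IsStronglyConvex σ) (S : Set (Toric.RealPoints σ))
    (hsemi : Toric.IsSemialgebraic S) (hclosed : IsClosed S) (hreg : S = closure (interior S))
    (hB : Toric.boundedFunctions S = ⊥)
    (hX : Toric.HasCompatibleToricCompletion σ S) :
    Toric.IsTotallyStable (Toric.nonnegFunctions S) := by
  classical
  obtain ⟨F, hσ, hF, hcompat⟩ := hX
  obtain ⟨R, hR⟩ := F.exists_generators
  have hS : S ⊆ closure (S ∩ Set.range (Torus.toPoint σ)) := by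
    conv_lhs => rw [hreg]
    refine closure_minimal (((dense_torus hrat).open_subset_closure_inter isOpen_interior).trans
      (closure_mono ?_)) isClosed_closure
    exact Set.inter_subset_inter_left _ interior_subset
  -- the rays of `σ` and those outside `σ` whose divisors meet the closure of `S`
  let ι := {u : F.RayVec // u ∈ R ∧ (latticeVec u.1 ∈ σ ∨
    (F.toSpace ⁻¹' F.divisor u ∩ closure (F.realChart hσ '' S)).Nonempty)}
  have : Finite ι := Finite.of_injective (fun u : ι => (⟨u.1, u.2.1⟩ : R))
    fun u v h => Subtype.ext (congrArg (fun w : R => w.1) h)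
  have hmemσ : ∀ m : Fin n → ℤ, (∀ u : ι, 0 ≤ pairing m (latticeVec u.1.1)) →
      m ∈ dualMonoid σ := by
    intro m hm
    obtain ⟨G, hG, hGR⟩ := hR σ hσ
    rw [hG, mem_dualMonoid_coneOf]
    intro g hg
    obtain ⟨u, hu, rfl⟩ := hGR g hg
    exact hm ⟨u, hu, Or.inl (hG ▸ latticeVec_mem_coneOf hg)⟩
  have hrec : ∀ m : Fin n → ℤ, (∀ u : ι, 0 ≤ pairing m (latticeVec u.1.1)) → m = 0 := by
    intro m hm
    have := eq_zero_of_chi_bounded hB (m := ⟨m, hmemσ m hm⟩)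
      (hF.chi_bounded hσ hR hS _ fun u hu h => hm ⟨u, hu, Or.inr h⟩)
    exact congrArg Subtype.val this
  intro U hU
  obtain ⟨B, hBU⟩ := exists_common_support U
  -- a bound for the pole orders of the functions in `U`
  obtain ⟨d, hd⟩ : ∃ d : ℕ, ∀ u : ι, ∀ m ∈ B, -(d : ℝ) ≤ pairing m.1 (latticeVec u.1.1) := by
    obtain ⟨c, hc⟩ := (Set.finite_range fun q : ι × B =>
      -pairing q.2.1.1 (latticeVec q.1.1.1)).bddAbove
    obtain ⟨d, hd⟩ := exists_nat_ge c
    refine ⟨d, fun u m hm => ?_⟩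
    have := hc ⟨(u, ⟨m, hm⟩), rfl⟩
    simp only at this
    linarith
  have hfin := finite_of_recession (fun u : ι => u.1.1) hrec d
  refine ⟨Submodule.span ℝ (chi '' (Subtype.val ⁻¹'
      {m : Fin n → ℤ | ∀ u : ι, -(d : ℝ) ≤ pairing m (latticeVec u.1.1)})),
    FiniteDimensional.span_of_finite ℝ ((hfin.preimage Subtype.val_injective.injOn).image _), ?_⟩
  intro r _ f hf hfU i
  refine mem_span_chi _ _ fun m hm u => ?_
  by_cases hu : latticeVec u.1.1 ∈ σ
  · have := m.2 _ hu
    have : (0 : ℝ) ≤ d := d.cast_nonneg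
    linarith
  · have hne := u.2.2.resolve_left hu
    have hdense := (hcompat _ (F.divisor_isComponentOf hσ hu)).resolve_left hne.ne_empty
    exact F.le_pairing_of_sum hσ hu hdense f hf _ (fun m hm => hd u m (hBU _ hfU m hm)) i m hm
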